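/- Let $N\ge 2$, let $s\in(0,1)$ and let $B_1(0)$ be the open unit ball of $\mathbb{R}^N$. Let $\mathbf u:\mathbb{R}^N\to\mathbb{R}$ be the fractional torsion function of the unit ball, that is, the explicit function $$\mathbf u(x)=\frac{2^{-2s}\,\Gamma(\frac N2)}{\Gamma(\frac N2+s)\,\Gamma(1+s)}\,(1-|x|^2)^s\ \text{ for } |x|<1,\qquad \mathbf u(x)=0\ \text{ for } |x|\ge 1 .$$ For $\sigma\in(0,1)$ write $$(-\Delta)^{\sigma}\mathbf u(x)=a_{N,\sigma}\lim_{\epsilon\to0^+}\int_{\mathbb{R}^N\setminus B_\epsilon(x)}\frac{\mathbf u(x)-\mathbf u(y)}{|x-y|^{N+2\sigma}}\,dy,\qquad a_{N,\sigma}=2^{2\sigma}\sigma\pi^{-\frac N2}\frac{\Gamma(\frac N2+\sigma)}{\Gamma(1-\sigma)} .$$ For every $0<t<\min\{1,2s\}$ and every $x$ with $|x|\neq1$, the integrals converge absolutely and the limit defining $(-\Delta)^{t/2}\mathbf u(x)$ exists, so that $(-\Delta)^{t/2}\mathbf u$ is defined almost everywhere in $\mathbb{R}^N$. Moreover: 1.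 If $0<t<s$, then $(-\Delta)^{t/2}\mathbf u\in L^p(\mathbb{R}^N)$ for all $1\le p\le\infty$. 2. $(-\Delta)^{s/2}\mathbf u\in L^p(\mathbb{R}^N)$ for all $1\le p<\infty$, but $(-\Delta)^{s/2}\mathbf u\notin L^\infty(B_1(0))$. 3. If $s<t<\min\{1,2s\}$, then $(-\Delta)^{t/2}\mathbf u\in L^p(\mathbb{R}^N)$ for all $1\le p<\frac1{t-s}$, but $(-\Delta)^{t/2}\mathbf u\notin L^p(B_1(0))$ for every $\frac1{t-s}\le p\le\infty$. -/

import Mathlib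

open MeasureTheory Filter Topology
open scoped ENNReal

/-- The normalization constant
`a_{N,σ} = 2^{2σ} σ π^{-N/2} Γ(N/2 + σ) / Γ(1 - σ)` of the fractional Laplacian. -/
noncomputable def fracLaplacianConst (N : ℕ) (σ : ℝ) : ℝ :=
  (2 : ℝ) ^ (2 * σ) * σ * Real.pi ^ (-((N : ℝ) / 2)) *
    (Real.Gamma ((N : ℝ) / 2 + σ) / Real.Gamma (1 - σ))

/-- The integrand `y ↦ (u(x) - u(y)) / |x - y|^{N + 2σ}`. -/
noncomputable def fracLaplacianIntegrand {N : ℕ} (σ : ℝ)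
    (u : EuclideanSpace ℝ (Fin N) → ℝ) (x y : EuclideanSpace ℝ (Fin N)) : ℝ :=
  (u x - u y) / ‖x - y‖ ^ ((N : ℝ) + 2 * σ)

/-- The truncation `a_{N,σ} ∫_{ℝ^N \ B_ε(x)} (u(x) - u(y)) / |x - y|^{N + 2σ} dy`. -/
noncomputable def truncFracLaplacian {N : ℕ} (σ : ℝ)
    (u : EuclideanSpace ℝ (Fin N) → ℝ) (x : EuclideanSpace ℝ (Fin N)) (ε : ℝ) : ℝ :=
  fracLaplacianConst N σ * ∫ y in (Metric.ball x ε)ᶜ, fracLaplacianIntegrand σ u x y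

/-- The principal value defining `(-Δ)^σ u (x)` exists and equals `L`: every truncated
integral converges absolutely, and the truncations tend to `L` as `ε → 0⁺`. -/
def HasFracLaplacianAt {N : ℕ} (σ : ℝ) (u : EuclideanSpace ℝ (Fin N) → ℝ)
    (x : EuclideanSpace ℝ (Fin N)) (L : ℝ) : Prop :=
  (∀ ε : ℝ, 0 < ε → IntegrableOn (fracLaplacianIntegrand σ u x) (Metric.ball x ε)ᶜ volume) ∧
    Tendsto (truncFracLaplacian σ u x) (𝓝[>] 0) (𝓝 L)

/-- The fractional Laplacian `(-Δ)^σ u (x)`, the limit of the truncations as `ε → 0⁺`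
(an arbitrary value where this limit does not exist; see `HasFracLaplacianAt`). -/
noncomputable def fracLaplacian {N : ℕ} (σ : ℝ) (u : EuclideanSpace ℝ (Fin N) → ℝ)
    (x : EuclideanSpace ℝ (Fin N)) : ℝ :=
  limUnder (𝓝[>] (0 : ℝ)) (truncFracLaplacian σ u x)

/-- The fractional torsion function of the unit ball of `ℝ^N`:
`2^{-2s} Γ(N/2) / (Γ(N/2 + s) Γ(1 + s)) (1 - |x|²)^s` in the unit ball, and `0` outside. -/
noncomputable def torsionFunction (N : ℕ) (s : ℝ) (x : EuclideanSpace ℝ (Fin N)) : ℝ :=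
  if ‖x‖ < 1 then
    (2 : ℝ) ^ (-(2 * s)) * Real.Gamma ((N : ℝ) / 2) /
      (Real.Gamma ((N : ℝ) / 2 + s) * Real.Gamma (1 + s)) * (1 - ‖x‖ ^ 2) ^ s
  else 0

/-! Up to a positive constant, `u` is the profile `v = (1 - |x|²)₊ ^ s`. Off the unit sphere `v` is
Lipschitz at `x`, so for `t < 1` the singular integral `I(x) = ∫ (v(x) - v(y)) |x - y|^(-N-t) dy`
converges absolutely and no cancellation is needed for the principal value.

Membership in `L^p`: for `s ≤ β ≤ 1` and `d = |1 - |x||` one has `|v(x) - v(y)| ≤ 2 d^(s-β) |x -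
y|^β` (`abs_ballPow_sub_le`). If `β > t` this gives `|I(x)| ≤ C (d^(-(β-s)) + 1)`, and `I` decays
like `|x|^(-N-t)` at infinity. For `t < s` take `β = s`, so that `I` is bounded. For `t ≥ s` take
`β` slightly above `t`, so that `(β - s) p < 1`.

Failure of `L^p`: put `δ = 1 - |x|²` with `|x| < 1` and symmetrize in `z = y - x`. Replacing `v(x ±
z)` by the half-space profiles `(δ ∓ 2 x·z)₊ ^ s` costs at most `|z|^(2s)` each, which is integrable
against `|z|^(-N-t)` near `0` because `t < 2s`. In polar coordinates and after scaling, the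
direction `e` contributes `δ^(s-t) κ^t ∫_0^(κ/δ)` of the one-dimensional second difference
`halfLineDiff`, with `κ = 2|x·e|`. For `s < t < 2s` its truncated integrals have limit at most
`(s/t)(B(1-t, s) - B(1-t, t-s)) < 0`; for `t = s` they tend to `-∞` logarithmically. Hence `I ≤ C -
c δ^(s-t)` near the sphere (`exists_ballPowFrac_le`), with `c` arbitrarily large when `t = s`. The
power `1/(t-s)` of `δ^(s-t)` is `1/δ`, which is not integrable. -/

/-! ### Hölder bounds for the profile, degenerating at the sphere. -/

/-- Interpolation between the Hölder and the Lipschitz estimate for a power `s ≤ 1`. -/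
lemma abs_rpow_sub_rpow_le {s β a b : ℝ} (hs : 0 < s) (hsβ : s ≤ β) (hβ : β ≤ 1)
    (ha : 0 < a) (hb : 0 ≤ b) : |a ^ s - b ^ s| ≤ a ^ (s - β) * |a - b| ^ β := by
  -- By homogeneity it suffices to treat `a = 1`, with `c = b / a`.
  have key : ∀ c : ℝ, 0 ≤ c → |1 - c ^ s| ≤ |1 - c| ^ β := by
    intro c hc
    have hβ0 : 0 < β := hs.trans_le hsβ
    rcases le_total c 1 with h | h
    · have h1 : c ^ s ≤ 1 := Real.rpow_le_one hc h hs.le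
      have h2 : c ≤ c ^ s := by
        simpa using Real.rpow_le_rpow_of_exponent_ge' hc h hs.le (hsβ.trans hβ)
      have h3 : (1 - c) ≤ (1 - c) ^ β := by
        simpa using Real.rpow_le_rpow_of_exponent_ge' (sub_nonneg.2 h) (by linarith) hβ0.le hβ
      rw [abs_of_nonneg (by linarith), abs_of_nonneg (by linarith)]
      linarith
    · have h1 : 1 ≤ c ^ s := Real.one_le_rpow h hs.le
      rw [abs_of_nonpos (by linarith), abs_of_nonpos (by linarith)]
      have hc1 : 0 ≤ -(1 - c) := by linarith
      have h2 : c ^ s - 1 ≤ (-(1 - c)) ^ s := by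
        have := Real.rpow_add_le_add_rpow hc1 zero_le_one hs.le (hsβ.trans hβ)
        simp only [neg_sub, sub_add_cancel, Real.one_rpow] at this ⊢
        linarith
      -- For `c - 1 ≤ 1` Bernoulli gives `c^s - 1 ≤ c - 1 ≤ (c - 1)^β`. For `c - 1 ≥ 1`
      -- subadditivity gives `(c - 1)^s`, and the exponent may be raised to `β`.
      rcases le_total (-(1 - c)) 1 with h3 | h3
      · have h4 : c ^ s ≤ 1 + s * (c - 1) := by
          simpa using rpow_one_add_le_one_add_mul_self (s := c - 1) (by linarith) hs.le
            (hsβ.trans hβ)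
        have h5 : -(1 - c) ≤ (-(1 - c)) ^ β := by
          simpa using Real.rpow_le_rpow_of_exponent_ge' hc1 h3 hβ0.le hβ
        nlinarith
      · have := Real.rpow_le_rpow_of_exponent_le h3 hsβ
        linarith
  have h := key (b / a) (by positivity)
  have e1 : a ^ s - b ^ s = a ^ s * (1 - (b / a) ^ s) := by
    rw [Real.div_rpow hb ha.le]
    field_simp
  have e2 : |a - b| = a * |1 - b / a| := by
    rw [← abs_of_pos ha, ← abs_mul, abs_of_pos ha]
    congr 1
    field_simp
  rw [e1, abs_mul, abs_of_nonneg (by positivity), e2, Real.mul_rpow ha.le (abs_nonneg _),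
    ← mul_assoc, ← Real.rpow_add ha, sub_add_cancel]
  gcongr

section Ball

variable {N : ℕ}

local notation "E" => EuclideanSpace ℝ (Fin N)

/-- The unnormalized torsion function `(1 - |x|²)₊ ^ s`. -/
noncomputable def ballPow (s : ℝ) (x : E) : ℝ := (max (1 - ‖x‖ ^ 2) 0) ^ s

lemma ballPow_nonneg (s : ℝ) (x : E) : 0 ≤ ballPow s x := by
  unfold ballPow; positivity

lemma ballPow_le_one {s : ℝ} (hs : 0 ≤ s) (x : E) : ballPow s x ≤ 1 :=
  Real.rpow_le_one (le_max_right _ _) (max_le (by nlinarith [sq_nonneg ‖x‖]) zero_le_one) hs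

lemma ballPow_of_one_le {s : ℝ} (hs : 0 < s) {x : E} (hx : 1 ≤ ‖x‖) : ballPow s x = 0 := by
  rw [ballPow, max_eq_right (by nlinarith), Real.zero_rpow hs.ne']

lemma measurable_ballPow (s : ℝ) : Measurable (ballPow s : E → ℝ) := by
  unfold ballPow; fun_prop

/-- The constant is the largest slope of `r ↦ r²` on `[0, 1]`, beyond which the positive part
vanishes. -/
lemma abs_posPart_one_sub_sq_sub_le (x y : E) :
    |max (1 - ‖x‖ ^ 2) 0 - max (1 - ‖y‖ ^ 2) 0| ≤ 2 * ‖x - y‖ := by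
  have h : ∀ a b : ℝ, 0 ≤ a → 0 ≤ b → a ≤ b →
      |max (1 - a ^ 2) 0 - max (1 - b ^ 2) 0| ≤ 2 * |a - b| := by
    intro a b ha hb hab
    rw [abs_of_nonpos (sub_nonpos.2 hab)]
    rcases le_total 1 a with h1 | h1
    · rw [max_eq_right (by nlinarith), max_eq_right (by nlinarith)]; simp; linarith
    rw [max_eq_left (by nlinarith : (0:ℝ) ≤ 1 - a ^ 2)]
    rcases le_total 1 b with h2 | h2
    · rw [max_eq_right (by nlinarith), abs_of_nonneg (by nlinarith)]; nlinarith
    · rw [max_eq_left (by nlinarith), abs_of_nonneg (by nlinarith)]; nlinarith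
  have h' : |max (1 - ‖x‖ ^ 2) 0 - max (1 - ‖y‖ ^ 2) 0| ≤ 2 * |‖x‖ - ‖y‖| := by
    rcases le_total ‖x‖ ‖y‖ with hxy | hxy
    · exact h _ _ (norm_nonneg _) (norm_nonneg _) hxy
    · rw [abs_sub_comm, abs_sub_comm ‖x‖]
      exact h _ _ (norm_nonneg _) (norm_nonneg _) hxy
  exact h'.trans (by gcongr; exact abs_norm_sub_norm_le x y)

lemma abs_ballPow_sub_le {s β : ℝ} (hs : 0 < s) (hsβ : s ≤ β) (hβ : β ≤ 1) {x : E} (hx : ‖x‖ ≠ 1)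
    (y : E) : |ballPow s x - ballPow s y| ≤ 2 * |1 - ‖x‖| ^ (s - β) * ‖x - y‖ ^ β := by
  have hd : 0 < |1 - ‖x‖| := abs_pos.2 (sub_ne_zero.2 hx.symm)
  have hL := abs_posPart_one_sub_sq_sub_le x y
  have h2 : ∀ r : ℝ, 0 ≤ r → r ≤ 1 → (2 : ℝ) ^ r ≤ 2 := fun r _ h1 => by
    simpa using Real.rpow_le_rpow_of_exponent_le one_le_two h1
  rcases lt_or_gt_of_ne hx with h | h
  · have ha : 0 < 1 - ‖x‖ ^ 2 := by nlinarith [norm_nonneg x]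
    have hm : max (1 - ‖x‖ ^ 2) 0 = 1 - ‖x‖ ^ 2 := max_eq_left ha.le
    rw [hm] at hL
    rw [ballPow, ballPow, hm]
    refine (abs_rpow_sub_rpow_le hs hsβ hβ ha (le_max_right _ _)).trans ?_
    have e1 : (1 - ‖x‖ ^ 2) ^ (s - β) ≤ |1 - ‖x‖| ^ (s - β) := by
      refine Real.rpow_le_rpow_of_nonpos hd ?_ (by linarith)
      rw [abs_of_pos (by linarith)]
      nlinarith [norm_nonneg x]
    have e2 : |1 - ‖x‖ ^ 2 - max (1 - ‖y‖ ^ 2) 0| ^ β ≤ 2 * ‖x - y‖ ^ β := by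
      refine (Real.rpow_le_rpow (abs_nonneg _) hL (by linarith)).trans ?_
      rw [Real.mul_rpow two_pos.le (norm_nonneg _)]
      gcongr
      exact h2 β (by linarith) hβ
    calc _ ≤ |1 - ‖x‖| ^ (s - β) * (2 * ‖x - y‖ ^ β) := by gcongr
      _ = _ := by ring
  · rw [ballPow_of_one_le hs h.le, zero_sub, abs_neg, abs_of_nonneg (ballPow_nonneg _ _)]
    rcases le_or_gt 1 ‖y‖ with hy | hy
    · rw [ballPow_of_one_le hs hy]; positivity
    have hm : max (1 - ‖x‖ ^ 2) 0 = 0 := max_eq_right (by nlinarith)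
    -- With `x` outside and `y` inside, the segment crosses the sphere; the nonpositive power `s -
    -- β` can then be moved from `‖x - y‖` to the distance to the sphere.
    have hdist : |1 - ‖x‖| ≤ ‖x - y‖ := by
      rw [abs_of_neg (by linarith)]
      have := norm_sub_norm_le x y
      linarith
    rw [hm, zero_sub, abs_neg, abs_of_nonneg (le_max_right _ _)] at hL
    have hp : 0 < ‖x - y‖ := hd.trans_le hdist
    calc ballPow s y ≤ (2 * ‖x - y‖) ^ s := Real.rpow_le_rpow (le_max_right _ _) hL hs.le
      _ ≤ 2 * ‖x - y‖ ^ s := by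
        rw [Real.mul_rpow two_pos.le (norm_nonneg _)]
        gcongr
        exact h2 s hs.le (hsβ.trans hβ)
      _ = 2 * ‖x - y‖ ^ (s - β) * ‖x - y‖ ^ β := by
        rw [mul_assoc, ← Real.rpow_add hp, sub_add_cancel]
      _ ≤ _ := by
        gcongr 2 * ?_ * _
        exact Real.rpow_le_rpow_of_nonpos hd hdist (by linarith)

lemma torsionFunction_eq {s : ℝ} (hs : 0 < s) (x : E) :
    torsionFunction N s x = (2 : ℝ) ^ (-(2 * s)) * Real.Gamma ((N : ℝ) / 2) /
      (Real.Gamma ((N : ℝ) / 2 + s) * Real.Gamma (1 + s)) * ballPow s x := by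
  unfold torsionFunction
  split_ifs with h
  · rw [ballPow, max_eq_left]
    nlinarith [norm_nonneg x]
  · rw [ballPow_of_one_le hs (not_lt.1 h), mul_zero]

/-! ### Integrable majorants and pointwise bounds for the singular integral. -/

lemma integrableOn_ball_norm_rpow [NeZero N] {α : ℝ} (hα : 0 < α) (r : ℝ) :
    IntegrableOn (fun z : E => ‖z‖ ^ (α - N)) (Metric.ball 0 r) := by
  have hN : 1 ≤ N := NeZero.one_le
  rw [integrableOn_fun_norm_addHaar volume (f := fun y => y ^ (α - N))]
  rcases le_or_gt r 0 with hr | hr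
  · simp [Set.Ioo_eq_empty (not_lt.2 hr)]
  have h : IntegrableOn (fun y : ℝ => y ^ (α - 1)) (Set.Ioo 0 r) := by
    have := intervalIntegral.intervalIntegrable_rpow' (a := 0) (b := r) (r := α - 1) (by linarith)
    rw [intervalIntegrable_iff_integrableOn_Ioo_of_le hr.le] at this
    exact this
  refine h.congr_fun (fun y hy => ?_) measurableSet_Ioo
  simp only [finrank_euclideanSpace, Fintype.card_fin, smul_eq_mul]
  rw [← Real.rpow_natCast, ← Real.rpow_add hy.1, Nat.cast_sub hN]
  congr 1
  push_cast; ring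

lemma integrableOn_compl_ball_norm_rpow {t : ℝ} (ht : 0 < t) {r : ℝ} (hr : 0 < r) :
    IntegrableOn (fun z : E => ‖z‖ ^ (-(N + t))) (Metric.ball 0 r)ᶜ := by
  have h := ((integrable_one_add_norm : (Module.finrank ℝ E : ℝ) < N + t → Integrable (fun x : E => (1 + ‖x‖) ^ (-(N + t))) volume)
    (by simpa using ht)).const_mul ((1 + r⁻¹) ^ (N + t))
  refine (h.integrableOn (s := (Metric.ball 0 r)ᶜ)).mono' ?_ ?_
  · exact Measurable.aestronglyMeasurable (by fun_prop)
  · filter_upwards [ae_restrict_mem Metric.isOpen_ball.measurableSet.compl] with z hz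
    have hz' : r ≤ ‖z‖ := by simpa using hz
    have hz0 : 0 < ‖z‖ := hr.trans_le hz'
    rw [Real.norm_of_nonneg (by positivity), Real.rpow_neg (by positivity),
      Real.rpow_neg (by positivity), ← Real.inv_rpow (by positivity), ← Real.inv_rpow (by positivity),
      ← Real.mul_rpow (by positivity) (by positivity)]
    refine Real.rpow_le_rpow (by positivity) ?_ (by positivity)
    have : 1 ≤ r⁻¹ * ‖z‖ := by
      rw [inv_mul_eq_div, one_le_div hr]; exact hz'
    field_simp
    field_simp at this
    nlinarith

/-- The singular integral of `(1 - |x|²)₊ ^ s` against the kernel `|x - y|^{-N-t}`. -/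
noncomputable def ballPowFrac (s t : ℝ) (x : E) : ℝ :=
  ∫ y, (ballPow s x - ballPow s y) / ‖x - y‖ ^ ((N : ℝ) + t)

lemma measurable_ballPowFrac (s t : ℝ) : Measurable (ballPowFrac s t : E → ℝ) := by
  have h : StronglyMeasurable (fun p : E × E =>
      (ballPow s p.1 - ballPow s p.2) / ‖p.1 - p.2‖ ^ ((N : ℝ) + t)) := by
    have := measurable_ballPow (N := N) s
    exact Measurable.stronglyMeasurable (by fun_prop)
  exact h.integral_prod_right.measurable

/-- The profile dominating the singular integrand. -/
noncomputable def kernelMajorant (β t c : ℝ) (z : E) : ℝ :=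
  c * (Metric.ball (0 : E) 1).indicator (fun z => ‖z‖ ^ (β - t - N)) z +
    (Metric.ball (0 : E) 1)ᶜ.indicator (fun z => ‖z‖ ^ (-((N : ℝ) + t))) z

lemma integrable_indicator_ball [NeZero N] {β t : ℝ} (hβt : t < β) :
    Integrable ((Metric.ball (0 : E) 1).indicator (fun z => ‖z‖ ^ (β - t - N))) :=
  (integrable_indicator_iff Metric.isOpen_ball.measurableSet).2
    (integrableOn_ball_norm_rpow (sub_pos.2 hβt) 1)

lemma integrable_indicator_compl_ball {t : ℝ} (ht : 0 < t) :
    Integrable ((Metric.ball (0 : E) 1)ᶜ.indicator (fun z => ‖z‖ ^ (-((N : ℝ) + t)))) :=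
  (integrable_indicator_iff Metric.isOpen_ball.measurableSet.compl).2
    (integrableOn_compl_ball_norm_rpow ht one_pos)

lemma integrable_kernelMajorant [NeZero N] {β t : ℝ} (ht : 0 < t) (hβt : t < β) (c : ℝ) :
    Integrable (kernelMajorant (N := N) β t c) :=
  ((integrable_indicator_ball hβt).const_mul c).add (integrable_indicator_compl_ball ht)

/-- For `|x - y| < 1` this is the Hölder bound; farther away the numerator is at most `1`, since the
profile takes values in `[0, 1]`. -/
lemma abs_div_le_kernelMajorant {s β t : ℝ} (hs : 0 < s) (hsβ : s ≤ β) (hβ : β ≤ 1)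
    {x : E} (hx : ‖x‖ ≠ 1) (y : E) :
    ‖(ballPow s x - ballPow s y) / ‖x - y‖ ^ ((N : ℝ) + t)‖ ≤
      kernelMajorant β t (2 * |1 - ‖x‖| ^ (s - β)) (x - y) := by
  have hd : 0 < |1 - ‖x‖| := abs_pos.2 (sub_ne_zero.2 hx.symm)
  rw [Real.norm_eq_abs, abs_div, abs_of_nonneg (by positivity : 0 ≤ ‖x - y‖ ^ ((N : ℝ) + t)),
    kernelMajorant]
  by_cases h : x - y ∈ Metric.ball (0 : E) 1
  · rw [Set.indicator_of_mem h, Set.indicator_of_notMem (by simpa using h), add_zero]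
    rcases eq_or_ne (x - y) 0 with h0 | h0
    · rw [sub_eq_zero.1 h0]
      simp only [sub_self, abs_zero, zero_div]
      positivity
    have hp : 0 < ‖x - y‖ := norm_pos_iff.2 h0
    have e : β - t - N + (N + t) = β := by ring
    rw [div_le_iff₀ (by positivity), mul_assoc, ← Real.rpow_add hp, e]
    exact abs_ballPow_sub_le hs hsβ hβ hx y
  · have h1 : 1 ≤ ‖x - y‖ := by simpa using h
    rw [Set.indicator_of_notMem h, Set.indicator_of_mem (by simpa using h), mul_zero, zero_add,
      Real.rpow_neg (by positivity), div_eq_mul_inv]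
    refine mul_le_of_le_one_left (by positivity) ?_
    rw [abs_le]
    constructor <;> linarith [ballPow_nonneg s x, ballPow_nonneg s y, ballPow_le_one hs.le x,
      ballPow_le_one hs.le y]

lemma measurable_singularIntegrand (s t : ℝ) (x : E) :
    Measurable (fun y : E => (ballPow s x - ballPow s y) / ‖x - y‖ ^ ((N : ℝ) + t)) := by
  have := measurable_ballPow (N := N) s
  fun_prop

/-- The Lipschitz choice `β = 1` works for every `t < 1`, however close `x` is to the sphere. -/
lemma integrable_singularIntegrand [NeZero N] {s t : ℝ} (hs : 0 < s) (hs1 : s ≤ 1) (ht : 0 < t)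
    (ht1 : t < 1) {x : E} (hx : ‖x‖ ≠ 1) :
    Integrable (fun y : E => (ballPow s x - ballPow s y) / ‖x - y‖ ^ ((N : ℝ) + t)) :=
  ((integrable_kernelMajorant ht ht1 _).comp_sub_left x).mono'
    (measurable_singularIntegrand s t x).aestronglyMeasurable
    (.of_forall fun y => abs_div_le_kernelMajorant hs hs1 le_rfl hx y)

/-- After translation, `x` enters the majorant only through the factor `|1 - ‖x‖| ^ (s - β)` of its
near part. -/
lemma abs_ballPowFrac_le [NeZero N] {s β t : ℝ} (hs : 0 < s) (hsβ : s ≤ β) (hβ : β ≤ 1)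
    (ht : 0 < t) (htβ : t < β) :
    ∃ C : ℝ, 0 ≤ C ∧ ∀ x : E, ‖x‖ ≠ 1 →
      |ballPowFrac s t x| ≤ C * (|1 - ‖x‖| ^ (-(β - s)) + 1) := by
  refine ⟨2 * (∫ z : E, (Metric.ball (0 : E) 1).indicator (fun z => ‖z‖ ^ (β - t - N)) z) +
    ∫ z : E, (Metric.ball (0 : E) 1)ᶜ.indicator (fun z => ‖z‖ ^ (-((N : ℝ) + t))) z, ?_, ?_⟩
  · refine add_nonneg (mul_nonneg two_pos.le ?_) ?_ <;>
    exact integral_nonneg (Set.indicator_nonneg fun z _ => by positivity)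
  intro x hx
  have h := norm_integral_le_of_norm_le
    ((integrable_kernelMajorant (N := N) ht htβ (2 * |1 - ‖x‖| ^ (s - β))).comp_sub_left x)
    (.of_forall fun y => abs_div_le_kernelMajorant (t := t) hs hsβ hβ hx y)
  rw [integral_sub_left_eq_self (fun y => kernelMajorant β t (2 * |1 - ‖x‖| ^ (s - β)) y)] at h
  refine h.trans ?_
  unfold kernelMajorant
  rw [integral_add ((integrable_indicator_ball htβ).const_mul _)
    (integrable_indicator_compl_ball ht), integral_const_mul]
  have h1 : 0 ≤ ∫ z : E, (Metric.ball (0 : E) 1).indicator (fun z => ‖z‖ ^ (β - t - N)) z :=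
    integral_nonneg (Set.indicator_nonneg fun z _ => by positivity)
  have h2 : 0 ≤ ∫ z : E, (Metric.ball (0 : E) 1)ᶜ.indicator
      (fun z => ‖z‖ ^ (-((N : ℝ) + t))) z :=
    integral_nonneg (Set.indicator_nonneg fun z _ => by positivity)
  rw [neg_sub]
  have h3 : 0 ≤ |1 - ‖x‖| ^ (s - β) := by positivity
  nlinarith [mul_nonneg h2 h3]

/-- Only `y` in the unit ball contributes, and `‖x‖ ≥ 3` is what makes `1 + ‖x‖ ≤ 2 (‖x‖ - 1) ≤ 2 ‖x
- y‖`. -/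
lemma abs_ballPowFrac_le_of_three_le {s t : ℝ} (hs : 0 < s) (ht : 0 < t) :
    ∃ C : ℝ, 0 ≤ C ∧ ∀ x : E, 3 ≤ ‖x‖ →
      |ballPowFrac s t x| ≤ C * (1 + ‖x‖) ^ (-((N : ℝ) + t)) := by
  refine ⟨volume.real (Metric.ball (0 : E) 1) * 2 ^ ((N : ℝ) + t), by positivity, ?_⟩
  intro x hx
  have hb : ∀ y : E, ‖(ballPow s x - ballPow s y) / ‖x - y‖ ^ ((N : ℝ) + t)‖ ≤
      (Metric.ball (0 : E) 1).indicator
        (fun _ => 2 ^ ((N : ℝ) + t) * (1 + ‖x‖) ^ (-((N : ℝ) + t))) y := by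
    intro y
    rw [ballPow_of_one_le hs (by linarith : 1 ≤ ‖x‖)]
    by_cases hy : y ∈ Metric.ball (0 : E) 1
    · rw [Set.indicator_of_mem hy]
      have hy1 : ‖y‖ < 1 := by simpa using hy
      have h1 := norm_sub_norm_le x y
      have h2 : 0 < ‖x - y‖ := by linarith
      rw [zero_sub, norm_div, norm_neg, Real.norm_of_nonneg (ballPow_nonneg _ _),
        Real.norm_of_nonneg (by positivity), Real.rpow_neg (by positivity), ← div_eq_mul_inv,
        div_le_div_iff₀ (by positivity) (by positivity)]
      have h3 : (1 + ‖x‖) ^ ((N : ℝ) + t) ≤ 2 ^ ((N : ℝ) + t) * ‖x - y‖ ^ ((N : ℝ) + t) := by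
        rw [← Real.mul_rpow (by positivity) (by positivity)]
        exact Real.rpow_le_rpow (by positivity) (by linarith) (by positivity)
      calc _ ≤ 1 * (1 + ‖x‖) ^ ((N : ℝ) + t) := by
            gcongr
            exact ballPow_le_one hs.le y
        _ ≤ _ := by rwa [one_mul]
    · rw [Set.indicator_of_notMem hy, ballPow_of_one_le hs (by simpa using hy)]
      simp
  have hi : IntegrableOn (fun _ : E => (2 : ℝ) ^ ((N : ℝ) + t) * (1 + ‖x‖) ^ (-((N : ℝ) + t)))
      (Metric.ball (0 : E) 1) := integrableOn_const measure_ball_lt_top.ne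
  have h := norm_integral_le_of_norm_le
    ((integrable_indicator_iff Metric.isOpen_ball.measurableSet).2 hi) (.of_forall hb)
  rw [integral_indicator_const _ Metric.isOpen_ball.measurableSet, smul_eq_mul, ← mul_assoc] at h
  exact h

/-- Global bound by an integrable tail and a power of the distance to the sphere. -/
lemma abs_ballPowFrac_le_add [NeZero N] {s β t : ℝ} (hs : 0 < s) (hsβ : s ≤ β) (hβ : β ≤ 1)
    (ht : 0 < t) (htβ : t < β) :
    ∃ C : ℝ, 0 ≤ C ∧ ∀ x : E, ‖x‖ ≠ 1 →
      |ballPowFrac s t x| ≤ C * ((1 + ‖x‖) ^ (-((N : ℝ) + t)) +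
        (Metric.ball (0 : E) 3).indicator (fun x => |1 - ‖x‖| ^ (-(β - s)) + 1) x) := by
  obtain ⟨C₁, hC₁, h₁⟩ := abs_ballPowFrac_le (N := N) hs hsβ hβ ht htβ
  obtain ⟨C₂, hC₂, h₂⟩ := abs_ballPowFrac_le_of_three_le (N := N) hs ht
  refine ⟨max C₁ C₂, by positivity, fun x hx => ?_⟩
  by_cases h : x ∈ Metric.ball (0 : E) 3
  · rw [Set.indicator_of_mem h]
    refine (h₁ x hx).trans ?_
    exact mul_le_mul (le_max_left _ _) (le_add_of_nonneg_left (by positivity)) (by positivity)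
      (by positivity)
  · rw [Set.indicator_of_notMem h, add_zero]
    refine (h₂ x (by simpa using h)).trans ?_
    gcongr
    exact le_max_right _ _

/-! ### `L^p` membership of the dominating functions. -/

lemma memLp_one_add_norm_rpow {r : ℝ} (hr : (N : ℝ) < r) {p : ℝ≥0∞} (hp : 1 ≤ p) :
    MemLp (fun x : E => (1 + ‖x‖) ^ (-r)) p := by
  have hm : AEStronglyMeasurable (fun x : E => (1 + ‖x‖) ^ (-r)) volume :=
    Measurable.aestronglyMeasurable (by fun_prop)
  have hr0 : 0 < r := (Nat.cast_nonneg N).trans_lt hr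
  rcases eq_or_ne p ∞ with rfl | hp'
  · refine memLp_top_of_bound hm 1 (.of_forall fun x => ?_)
    rw [Real.norm_of_nonneg (by positivity)]
    exact Real.rpow_le_one_of_one_le_of_nonpos (by linarith [norm_nonneg x]) (by linarith)
  have h1 : 1 ≤ p.toReal := by simpa using ENNReal.toReal_mono hp' hp
  rw [← integrable_norm_rpow_iff hm (by positivity) hp']
  have : Integrable (fun x : E => (1 + ‖x‖) ^ (-(r * p.toReal))) volume := by
    refine integrable_one_add_norm ?_
    rw [finrank_euclideanSpace, Fintype.card_fin]
    nlinarith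
  refine this.congr (.of_forall fun x => ?_)
  simp only
  rw [Real.norm_of_nonneg (by positivity), ← Real.rpow_mul (by positivity), neg_mul]

lemma integrableOn_abs_one_sub_rpow {e : ℝ} (he : -1 < e) :
    IntegrableOn (fun y : ℝ => |1 - y| ^ e) (Set.Icc 0 3) := by
  have h1 : IntervalIntegrable (fun u : ℝ => |u| ^ e) volume 0 2 := by
    refine (intervalIntegral.intervalIntegrable_rpow' (a := 0) (b := 2) he).congr ?_
    intro u hu
    rw [Set.uIoc_of_le zero_le_two] at hu
    simp only
    rw [abs_of_pos hu.1]
  have h2 : IntervalIntegrable (fun u : ℝ => |u| ^ e) volume 0 (-2) := by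
    have := (IntervalIntegrable.iff_comp_neg (f := fun u : ℝ => |u| ^ e) (by finiteness)).1 h1
    simpa using this
  have h3 := (h2.symm.trans h1).comp_sub_left 1
  rw [intervalIntegrable_iff'] at h3
  refine h3.mono_set (fun y hy => ?_)
  rw [Set.uIcc_of_ge (by norm_num)]
  constructor <;> linarith [hy.1, hy.2]

/-- Radially the weight `r^(N-1)` is bounded on `[0, 3]`, so only the one-dimensional singularity at
`r = 1` matters. -/
lemma memLp_indicator_abs_one_sub_norm_rpow [NeZero N] {γ : ℝ} {p : ℝ≥0∞} (hp0 : p ≠ 0)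
    (hp : p ≠ ∞) (hγ : γ * p.toReal < 1) :
    MemLp ((Metric.ball (0 : E) 3).indicator (fun x => |1 - ‖x‖| ^ (-γ))) p := by
  rw [memLp_indicator_iff_restrict Metric.isOpen_ball.measurableSet,
    ← integrable_norm_rpow_iff (Measurable.aestronglyMeasurable (by fun_prop)) hp0 hp]
  have e : ∀ x : E, ‖|1 - ‖x‖| ^ (-γ)‖ ^ p.toReal = |1 - ‖x‖| ^ (-(γ * p.toReal)) := fun x => by
    rw [Real.norm_of_nonneg (by positivity), ← Real.rpow_mul (by positivity), neg_mul]
  simp_rw [e]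
  refine (integrableOn_fun_norm_addHaar volume
    (f := fun y => |1 - y| ^ (-(γ * p.toReal)))).2 ?_
  have h := integrableOn_abs_one_sub_rpow (e := -(γ * p.toReal)) (by linarith)
  refine IntegrableOn.mono_set ?_ Set.Ioo_subset_Icc_self
  simp only [smul_eq_mul]
  exact h.continuousOn_mul (by fun_prop) isCompact_Icc

/-! ### The fractional Laplacian as an absolutely convergent integral. -/

lemma ae_norm_ne_one [NeZero N] : ∀ᵐ x : E, ‖x‖ ≠ 1 := by
  have := Measure.addHaar_sphere (volume : Measure E) 0 1
  rw [ae_iff]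
  convert this using 2
  ext x
  simp

/-- The factor relating the fractional Laplacian of the torsion function to `ballPowFrac`. -/
noncomputable def torsionFracConst (N : ℕ) (s t : ℝ) : ℝ :=
  fracLaplacianConst N (t / 2) * ((2 : ℝ) ^ (-(2 * s)) * Real.Gamma ((N : ℝ) / 2) /
      (Real.Gamma ((N : ℝ) / 2 + s) * Real.Gamma (1 + s)))

lemma torsionFracConst_pos [NeZero N] {s t : ℝ} (hs : 0 < s) (ht : 0 < t) (ht1 : t < 1) :
    0 < torsionFracConst N s t := by
  have hN : (0 : ℝ) < N := Nat.cast_pos.2 (NeZero.pos N)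
  have h1 := Real.Gamma_pos_of_pos (s := (N : ℝ) / 2) (by positivity)
  have h2 := Real.Gamma_pos_of_pos (s := (N : ℝ) / 2 + s) (by positivity)
  have h3 := Real.Gamma_pos_of_pos (s := 1 + s) (by positivity)
  have h4 := Real.Gamma_pos_of_pos (s := (N : ℝ) / 2 + t / 2) (by positivity)
  have h5 := Real.Gamma_pos_of_pos (s := 1 - t / 2) (by linarith)
  unfold torsionFracConst fracLaplacianConst
  positivity

/-- The integrand is integrable on the whole space, so the removed balls, whose volume tends to `0`,
contribute nothing in the limit. -/
lemma hasFracLaplacianAt_torsionFunction [NeZero N] {s t : ℝ} (hs : 0 < s) (hs1 : s ≤ 1)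
    (ht : 0 < t) (ht1 : t < 1) {x : E} (hx : ‖x‖ ≠ 1) :
    HasFracLaplacianAt (t / 2) (torsionFunction N s) x
      (torsionFracConst N s t * ballPowFrac s t x) := by
  set c := (2 : ℝ) ^ (-(2 * s)) * Real.Gamma ((N : ℝ) / 2) /
      (Real.Gamma ((N : ℝ) / 2 + s) * Real.Gamma (1 + s)) with hc
  have e : ∀ y, fracLaplacianIntegrand (t / 2) (torsionFunction N s) x y =
      c * ((ballPow s x - ballPow s y) / ‖x - y‖ ^ ((N : ℝ) + t)) := fun y => by
    rw [fracLaplacianIntegrand, torsionFunction_eq hs, torsionFunction_eq hs, ← hc,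
      mul_div_cancel₀ t two_ne_zero]
    ring
  have hi := (integrable_singularIntegrand (N := N) hs hs1 ht ht1 hx).const_mul c
  simp_rw [← e] at hi
  refine ⟨fun ε _ => hi.integrableOn, ?_⟩
  have hball : Tendsto (fun ε : ℝ => volume (Metric.ball x ε)) (𝓝[>] 0) (𝓝 0) := by
    have h1 : Tendsto (fun ε : ℝ => ENNReal.ofReal (ε ^ N) * volume (Metric.ball (0 : E) 1))
        (𝓝[>] 0) (𝓝 (ENNReal.ofReal (0 ^ N) * volume (Metric.ball (0 : E) 1))) := by
      refine ENNReal.Tendsto.mul_const ?_ (Or.inr measure_ball_lt_top.ne)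
      exact ((ENNReal.continuous_ofReal.comp (continuous_pow N)).tendsto 0).mono_left
        nhdsWithin_le_nhds
    rw [zero_pow (NeZero.ne N), ENNReal.ofReal_zero, zero_mul] at h1
    refine h1.congr' ?_
    filter_upwards [self_mem_nhdsWithin] with ε hε
    rw [Measure.addHaar_ball_of_pos _ _ hε, finrank_euclideanSpace, Fintype.card_fin]
  have h0 := hi.tendsto_setIntegral_nhds_zero hball
  have e2 : torsionFracConst N s t * ballPowFrac s t x = fracLaplacianConst N (t / 2) *
      ((∫ y, fracLaplacianIntegrand (t / 2) (torsionFunction N s) x y) - 0) := by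
    simp_rw [e]
    rw [integral_const_mul, torsionFracConst, ballPowFrac, ← hc]
    ring
  rw [e2]
  have h2 := (tendsto_const_nhds (x := ∫ y, fracLaplacianIntegrand (t / 2)
    (torsionFunction N s) x y)).sub h0
  refine (h2.const_mul (fracLaplacianConst N (t / 2))).congr fun ε => ?_
  rw [truncFracLaplacian, ← integral_add_compl Metric.isOpen_ball.measurableSet hi]
  ring

lemma fracLaplacian_torsionFunction [NeZero N] {s t : ℝ} (hs : 0 < s) (hs1 : s ≤ 1)
    (ht : 0 < t) (ht1 : t < 1) {x : E} (hx : ‖x‖ ≠ 1) :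
    fracLaplacian (t / 2) (torsionFunction N s) x = torsionFracConst N s t * ballPowFrac s t x :=
  (hasFracLaplacianAt_torsionFunction hs hs1 ht ht1 hx).2.limUnder_eq

lemma fracLaplacian_torsionFunction_ae [NeZero N] {s t : ℝ} (hs : 0 < s) (hs1 : s ≤ 1)
    (ht : 0 < t) (ht1 : t < 1) :
    fracLaplacian (t / 2) (torsionFunction N s) =ᵐ[volume]
      fun x => torsionFracConst N s t * ballPowFrac s t x := by
  filter_upwards [ae_norm_ne_one] with x hx using fracLaplacian_torsionFunction hs hs1 ht ht1 hx

/-- The disjunction separates the bounded case `β = s`, where `p = ∞` is allowed, from the case of a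
genuine singularity on the sphere. -/
lemma memLp_fracLaplacian_torsionFunction [NeZero N] {s β t : ℝ} (hs : 0 < s) (hsβ : s ≤ β)
    (hβ : β ≤ 1) (ht : 0 < t) (ht1 : t < 1) (htβ : t < β) {p : ℝ≥0∞} (hp : 1 ≤ p)
    (h : β = s ∨ p ≠ ∞ ∧ (β - s) * p.toReal < 1) :
    MemLp (fracLaplacian (t / 2) (torsionFunction N s)) p volume := by
  refine (memLp_congr_ae (fracLaplacian_torsionFunction_ae hs (hsβ.trans hβ) ht ht1)).2 ?_
  refine MemLp.const_mul ?_ _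
  obtain ⟨C, -, hC⟩ := abs_ballPowFrac_le_add (N := N) hs hsβ hβ ht htβ
  have hconst : MemLp ((Metric.ball (0 : E) 3).indicator (fun _ => (1 : ℝ))) p :=
    memLp_indicator_const p Metric.isOpen_ball.measurableSet 1 (Or.inr measure_ball_lt_top.ne)
  have hpow : MemLp ((Metric.ball (0 : E) 3).indicator (fun x => |1 - ‖x‖| ^ (-(β - s)))) p := by
    rcases h with rfl | ⟨hp', h⟩
    -- The exponent is `0`, so the power is identically `1`, also on the sphere where `0 ^ 0 = 1`.
    · simpa using hconst
    · exact memLp_indicator_abs_one_sub_norm_rpow (by positivity) hp' h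
  have hg := (((memLp_one_add_norm_rpow (N := N) (r := N + t) (by linarith) hp).add
    (hpow.add hconst)).const_mul C)
  refine hg.mono' (measurable_ballPowFrac s t).aestronglyMeasurable ?_
  filter_upwards [ae_norm_ne_one] with x hx
  refine (hC x hx).trans (le_of_eq ?_)
  by_cases hx3 : x ∈ Metric.ball (0 : E) 3
  · simp only [Pi.add_apply, Set.indicator_of_mem hx3]
  · simp only [Pi.add_apply, Set.indicator_of_notMem hx3, add_zero]

end Ball

/-! ### The one-dimensional half-line problem. -/

/-- The second difference at `1` of the half-line profile `y₊ ^ s`, over `ρ ^ (1 + t)`. -/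
noncomputable def halfLineDiff (s t ρ : ℝ) : ℝ :=
  (2 - (max (1 - ρ) 0) ^ s - (1 + ρ) ^ s) * ρ ^ (-1 - t)

lemma abs_one_sub_rpow_le {s b : ℝ} (hs : 0 < s) (hs1 : s ≤ 1) (hb : 0 ≤ b) :
    |1 - b ^ s| ≤ |1 - b| := by
  simpa using abs_rpow_sub_rpow_le hs hs1 le_rfl one_pos hb

lemma mul_rpow_neg_one_sub {t ρ : ℝ} (hρ : 0 < ρ) : ρ * ρ ^ (-1 - t) = ρ ^ (-t) := by
  have := Real.rpow_add hρ 1 (-1 - t)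
  rw [Real.rpow_one] at this
  rw [← this]
  ring_nf

lemma intervalIntegrable_of_abs_le {t M : ℝ} (ht : t < 1) (hM : 0 ≤ M) {f : ℝ → ℝ}
    (hf : Measurable f) (h : ∀ ρ, 0 < ρ → |f ρ| ≤ ρ) :
    IntervalIntegrable (fun ρ => f ρ * ρ ^ (-1 - t)) volume 0 M := by
  have hi : IntervalIntegrable (fun ρ : ℝ => ρ ^ (-t)) volume 0 M :=
    intervalIntegral.intervalIntegrable_rpow' (by linarith)
  refine hi.mono_fun' (Measurable.aestronglyMeasurable (by fun_prop)) ?_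
  rw [Set.uIoc_of_le hM]
  filter_upwards [ae_restrict_mem measurableSet_Ioc] with ρ hρ
  have := hρ.1
  rw [norm_mul, Real.norm_of_nonneg (by positivity : 0 ≤ ρ ^ (-1 - t)), ← mul_rpow_neg_one_sub this]
  gcongr
  exact h ρ this

lemma abs_left_le {s ρ : ℝ} (hs : 0 < s) (hs1 : s ≤ 1) (hρ : 0 < ρ) :
    |1 - (max (1 - ρ) 0) ^ s| ≤ ρ := by
  refine (abs_one_sub_rpow_le hs hs1 (le_max_right _ _)).trans ?_
  rw [abs_le]
  rcases le_total (1 - ρ) 0 with h | h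
  · rw [max_eq_right h]; constructor <;> linarith
  · rw [max_eq_left h]; constructor <;> linarith

lemma abs_right_le {s ρ : ℝ} (hs : 0 < s) (hs1 : s ≤ 1) (hρ : 0 < ρ) :
    |(1 + ρ) ^ s - 1| ≤ ρ := by
  rw [abs_sub_comm]
  refine (abs_one_sub_rpow_le hs hs1 (by positivity)).trans ?_
  rw [abs_le]
  constructor <;> linarith

lemma intervalIntegrable_left {s t M : ℝ} (hs : 0 < s) (hs1 : s ≤ 1) (ht : t < 1) (hM : 0 ≤ M) :
    IntervalIntegrable (fun ρ => (1 - (max (1 - ρ) 0) ^ s) * ρ ^ (-1 - t)) volume 0 M :=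
  intervalIntegrable_of_abs_le ht hM (by fun_prop) fun _ => abs_left_le hs hs1

lemma intervalIntegrable_right {s t M : ℝ} (hs : 0 < s) (hs1 : s ≤ 1) (ht : t < 1) (hM : 0 ≤ M) :
    IntervalIntegrable (fun ρ => ((1 + ρ) ^ s - 1) * ρ ^ (-1 - t)) volume 0 M :=
  intervalIntegrable_of_abs_le ht hM (by fun_prop) fun _ => abs_right_le hs hs1

/-- Since `t < 1` in the applications, the two one-sided first differences are integrable separately
and can be evaluated one at a time. -/
lemma halfLineDiff_eq (s t ρ : ℝ) : halfLineDiff s t ρ =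
    (1 - (max (1 - ρ) 0) ^ s) * ρ ^ (-1 - t) - ((1 + ρ) ^ s - 1) * ρ ^ (-1 - t) := by
  unfold halfLineDiff; ring

lemma intervalIntegrable_halfLineDiff {s t M : ℝ} (hs : 0 < s) (hs1 : s ≤ 1) (ht : t < 1)
    (hM : 0 ≤ M) : IntervalIntegrable (halfLineDiff s t) volume 0 M := by
  rw [funext (halfLineDiff_eq s t)]
  exact (intervalIntegrable_left hs hs1 ht hM).sub (intervalIntegrable_right hs hs1 ht hM)

lemma intervalIntegrable_beta {a b : ℝ} (ha : 0 < a) (hb : 0 < b) :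
    IntervalIntegrable (fun x : ℝ => x ^ (a - 1) * (1 - x) ^ (b - 1)) volume 0 1 := by
  have h := (Complex.betaIntegral_convergent (u := a) (v := b) (by simpa) (by simpa)).norm
  rw [intervalIntegrable_iff_integrableOn_Ioo_of_le zero_le_one] at h ⊢
  refine h.congr_fun (fun x hx => ?_) measurableSet_Ioo
  have h1 : 0 < 1 - x := sub_pos.2 hx.2
  simp only [norm_mul]
  rw [Complex.norm_cpow_eq_rpow_re_of_pos hx.1]
  have := Complex.norm_cpow_eq_rpow_re_of_pos h1 (b - 1)
  push_cast at this
  rw [this]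
  simp

/-- An integration by parts against `ρ ^ (-1 - t)` starting at a zero of the other factor. -/
lemma integral_mul_rpow_eq {t M : ℝ} (ht0 : 0 < t) (ht : t < 1) (hM : 0 < M) {f f' : ℝ → ℝ}
    (hf : Measurable f) (h : ∀ ρ, 0 < ρ → |f ρ| ≤ ρ) (hc : ContinuousWithinAt f (Set.Iio M) M)
    (hd : ∀ ρ ∈ Set.Ioo 0 M, HasDerivAt f (f' ρ) ρ)
    (hi : IntervalIntegrable (fun ρ => f' ρ * ρ ^ (-t)) volume 0 M) :
    ∫ ρ in 0..M, f ρ * ρ ^ (-1 - t) =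
      t⁻¹ * (∫ ρ in 0..M, f' ρ * ρ ^ (-t)) - t⁻¹ * (f M * M ^ (-t)) := by
  have hi1 := intervalIntegrable_of_abs_le ht hM.le hf h
  -- Only one-sided limits at the endpoints are used, because `f'` may blow up at `M`, as it does
  -- for `(1 - ρ)^s` at `1` when `s < 1`.
  have key := intervalIntegral.integral_eq_sub_of_hasDerivAt_of_tendsto
    (f := fun ρ => -t⁻¹ * (f ρ * ρ ^ (-t)))
    (f' := fun ρ => f ρ * ρ ^ (-1 - t) - t⁻¹ * (f' ρ * ρ ^ (-t))) (fa := 0)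
    (fb := -t⁻¹ * (f M * M ^ (-t))) hM ?_ (hi1.sub (hi.const_mul _)) ?_ ?_
  · rw [intervalIntegral.integral_sub hi1 (hi.const_mul _),
      intervalIntegral.integral_const_mul] at key
    linarith
  · intro ρ hρ
    have h1 := (hd ρ hρ).mul (Real.hasDerivAt_rpow_const (x := ρ) (p := -t) (Or.inl hρ.1.ne'))
    refine (h1.const_mul (-t⁻¹)).congr_deriv ?_
    have e : -t - 1 = -1 - t := by ring
    rw [e]
    field_simp
    ring
  · have h0 : Tendsto (fun ρ : ℝ => t⁻¹ * ρ ^ (1 - t)) (𝓝[>] 0) (𝓝 0) := by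
      have : Tendsto (fun ρ : ℝ => t⁻¹ * ρ ^ (1 - t)) (𝓝 0) (𝓝 (t⁻¹ * 0 ^ (1 - t))) :=
        ((Real.continuous_rpow_const (by linarith)).tendsto 0).const_mul _
      rw [Real.zero_rpow (by linarith), mul_zero] at this
      exact this.mono_left nhdsWithin_le_nhds
    refine squeeze_zero_norm' ?_ h0
    filter_upwards [self_mem_nhdsWithin] with ρ (hρ : 0 < ρ)
    rw [norm_mul, norm_mul, norm_neg, norm_inv, Real.norm_of_nonneg ht0.le,
      Real.norm_of_nonneg (by positivity : 0 ≤ ρ ^ (-t)), sub_eq_add_neg,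
      Real.rpow_one_add' hρ.le (by linarith)]
    gcongr
    exact h ρ hρ
  · refine Tendsto.const_mul _ (Tendsto.mul hc ?_)
    exact (Real.continuousAt_rpow_const _ _ (Or.inl hM.ne')).tendsto.mono_left nhdsWithin_le_nhds

/-- Integration by parts on `[0, 1]` gives `(s/t) B(1-t, s) - 1/t`; on `[1, M]` the integrand is
`ρ^(-1-t)` and contributes `1/t - M^(-t)/t`. The constants cancel and the last term is dropped. -/
lemma integral_left_le {s t M : ℝ} (hs : 0 < s) (hs1 : s ≤ 1) (ht0 : 0 < t) (ht : t < 1)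
    (hM : 1 ≤ M) : ∫ ρ in 0..M, (1 - (max (1 - ρ) 0) ^ s) * ρ ^ (-1 - t) ≤
      s / t * ∫ x in (0 : ℝ)..1, x ^ (-t) * (1 - x) ^ (s - 1) := by
  have hb := intervalIntegrable_beta (a := 1 - t) (b := s) (by linarith) hs
  rw [sub_sub_cancel_left] at hb
  have hi : IntervalIntegrable (fun ρ : ℝ => (s * (1 - ρ) ^ (s - 1)) * ρ ^ (-t)) volume 0 1 := by
    refine (hb.const_mul s).congr fun x _ => ?_
    ring
  have h1 := integral_mul_rpow_eq ht0 ht one_pos (f := fun ρ => 1 - (max (1 - ρ) 0) ^ s)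
    (f' := fun ρ => s * (1 - ρ) ^ (s - 1)) (by fun_prop) (fun _ => abs_left_le hs hs1) ?_ ?_ hi
  · have hii := (intervalIntegrable_left hs hs1 ht (zero_le_one.trans hM))
    rw [← intervalIntegral.integral_add_adjacent_intervals (b := 1)
      (intervalIntegrable_left hs hs1 ht zero_le_one)
      (hii.mono_set (by rw [Set.uIcc_of_le hM, Set.uIcc_of_le (by linarith)]
                        exact Set.Icc_subset_Icc_left zero_le_one)), h1]
    have h2 : ∫ ρ in (1 : ℝ)..M, (1 - (max (1 - ρ) 0) ^ s) * ρ ^ (-1 - t) =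
        ∫ ρ in (1 : ℝ)..M, ρ ^ (-1 - t) := by
      refine intervalIntegral.integral_congr fun ρ hρ => ?_
      rw [Set.uIcc_of_le hM] at hρ
      rw [max_eq_right (by linarith [hρ.1]), Real.zero_rpow hs.ne']
      ring
    rw [h2, integral_rpow (Or.inr ⟨by linarith, by
      rw [Set.uIcc_of_le hM]; exact fun h => by linarith [h.1]⟩)]
    have h3 : ∫ ρ in (0 : ℝ)..1, s * (1 - ρ) ^ (s - 1) * ρ ^ (-t) =
        s * ∫ x in (0 : ℝ)..1, x ^ (-t) * (1 - x) ^ (s - 1) := by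
      rw [← intervalIntegral.integral_const_mul]
      congr 1
      ext x
      ring
    rw [h3]
    have e : -1 - t + 1 = -t := by ring
    rw [e]
    simp only [sub_self, max_self, Real.zero_rpow hs.ne', Real.one_rpow]
    have h4 : 0 ≤ t⁻¹ * M ^ (-t) := by positivity
    have h5 : (M ^ (-t) - 1) / -t = t⁻¹ - t⁻¹ * M ^ (-t) := by field_simp; ring
    rw [h5, div_eq_mul_inv]
    linarith
  · refine Continuous.continuousWithinAt ?_
    exact continuous_const.sub (Continuous.rpow_const (by fun_prop) fun _ => Or.inr hs.le)
  · intro ρ hρ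
    have h1 : 0 < 1 - ρ := sub_pos.2 hρ.2
    have h2 : HasDerivAt (fun ρ : ℝ => 1 - (1 - ρ) ^ s) (s * (1 - ρ) ^ (s - 1)) ρ := by
      have := (((hasDerivAt_id ρ).const_sub 1).rpow_const (p := s) (Or.inl h1.ne')).const_sub 1
      refine this.congr_deriv ?_
      simp
    refine h2.congr_of_eventuallyEq ?_
    filter_upwards [Iio_mem_nhds hρ.2] with y hy
    rw [max_eq_left (sub_nonneg.2 (le_of_lt hy))]

lemma intervalIntegrable_beta_of_lt_one {t b m : ℝ} (ht : t < 1) (hm0 : 0 ≤ m) (hm1 : m < 1) :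
    IntervalIntegrable (fun x : ℝ => x ^ (-t) * (1 - x) ^ b) volume 0 m := by
  refine (intervalIntegral.intervalIntegrable_rpow' (r := -t) (by linarith)).mul_continuousOn ?_
  intro x hx
  rw [Set.uIcc_of_le hm0] at hx
  exact ContinuousAt.continuousWithinAt
    (ContinuousAt.rpow_const (by fun_prop) (Or.inl (by linarith [hx.2])))

/-- The substitution is `x = ρ / (1 + ρ)`, for which `1 - x = 1 / (1 + ρ)`. -/
lemma integral_one_add_rpow_mul_rpow {s t M : ℝ} (ht : t < 1) (hM : 0 < M) :
    ∫ ρ in 0..M, (1 + ρ) ^ (s - 1) * ρ ^ (-t) =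
      ∫ x in (0 : ℝ)..(M / (1 + M)), x ^ (-t) * (1 - x) ^ (t - s - 1) := by
  have himg : ∀ ρ : ℝ, 0 ≤ ρ → 1 - ρ / (1 + ρ) = (1 + ρ)⁻¹ := fun ρ hρ => by
    field_simp; ring
  have hcomp : ∀ ρ ∈ Set.uIcc 0 M, (1 + ρ) ^ (s - 1) * ρ ^ (-t) =
      (ρ / (1 + ρ)) ^ (-t) * (1 - ρ / (1 + ρ)) ^ (t - s - 1) * ((1 + ρ) ^ 2)⁻¹ := by
    intro ρ hρ
    rw [Set.uIcc_of_le hM.le] at hρ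
    have hp : 0 < 1 + ρ := by linarith [hρ.1]
    rw [himg ρ hρ.1, Real.div_rpow hρ.1 hp.le, ← Real.rpow_neg_one (1 + ρ), ← Real.rpow_mul hp.le,
      ← Real.rpow_natCast (1 + ρ) 2, ← Real.rpow_neg hp.le, div_eq_mul_inv, ← Real.rpow_neg hp.le]
    rw [mul_assoc, mul_assoc, ← Real.rpow_add hp, ← Real.rpow_add hp, mul_comm]
    congr 2
    push_cast; ring
  have hint : IntervalIntegrable (fun ρ : ℝ => (1 + ρ) ^ (s - 1) * ρ ^ (-t)) volume 0 M := by
    refine (intervalIntegral.intervalIntegrable_rpow' (r := -t) (by linarith)).continuousOn_mul ?_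
    intro ρ hρ
    rw [Set.uIcc_of_le hM.le] at hρ
    exact ContinuousAt.continuousWithinAt
      (ContinuousAt.rpow_const (by fun_prop) (Or.inl (by linarith [hρ.1])))
  have hm1 : M / (1 + M) < 1 := by rw [div_lt_one (by linarith)]; linarith
  have hm0 : 0 < M / (1 + M) := by positivity
  have hintx := intervalIntegrable_beta_of_lt_one (b := t - s - 1) ht hm0.le hm1
  have hsub : ∀ ρ : ℝ, 0 ≤ ρ → ρ ≤ M → ρ / (1 + ρ) ≤ M / (1 + M) := fun ρ h0 h1 => by
    rw [div_le_div_iff₀ (by linarith) (by linarith)]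
    nlinarith
  have key := intervalIntegral.integral_comp_mul_deriv''' (a := 0) (b := M)
    (f := fun ρ : ℝ => ρ / (1 + ρ)) (f' := fun ρ => ((1 + ρ) ^ 2)⁻¹)
    (g := fun x : ℝ => x ^ (-t) * (1 - x) ^ (t - s - 1)) ?_ ?_ ?_ ?_ ?_
  · simp only [zero_div] at key
    rw [← key]
    exact intervalIntegral.integral_congr hcomp
  · intro ρ hρ
    rw [Set.uIcc_of_le hM.le] at hρ
    exact ContinuousAt.continuousWithinAt
      (ContinuousAt.div (by fun_prop) (by fun_prop) (by linarith [hρ.1]))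
  · intro ρ hρ
    rw [min_eq_left hM.le, max_eq_right hM.le] at hρ
    have h1 : (1 + ρ) ≠ 0 := by linarith [hρ.1]
    refine ((hasDerivAt_id ρ).div ((hasDerivAt_id ρ).const_add 1) h1).hasDerivWithinAt.congr_deriv ?_
    simp only [id]
    field_simp
    ring
  · rintro x ⟨ρ, hρ, rfl⟩
    rw [min_eq_left hM.le, max_eq_right hM.le] at hρ
    have h1 : 0 < ρ / (1 + ρ) := div_pos hρ.1 (by linarith [hρ.1])
    have h2 := hsub ρ hρ.1.le hρ.2.le
    refine ContinuousAt.continuousWithinAt (ContinuousAt.mul ?_ ?_)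
    · exact ContinuousAt.rpow_const (by fun_prop) (Or.inl h1.ne')
    · exact ContinuousAt.rpow_const (by fun_prop) (Or.inl (by linarith))
  · rw [intervalIntegrable_iff'] at hintx
    refine hintx.mono_set ?_
    rintro x ⟨ρ, hρ, rfl⟩
    rw [Set.uIcc_of_le hM.le] at hρ
    rw [Set.uIcc_of_le hm0.le]
    exact ⟨div_nonneg hρ.1 (by linarith [hρ.1]), hsub ρ hρ.1 hρ.2⟩
  · rw [intervalIntegrable_iff'] at hint
    exact hint.congr_fun hcomp measurableSet_uIcc

/-- Integration by parts again; the boundary term at `M` is controlled by `(1 + M)^s - 1 ≤ M^s`. -/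
lemma le_integral_right {s t M : ℝ} (hs : 0 < s) (hs1 : s ≤ 1) (ht0 : 0 < t) (ht : t < 1)
    (hM : 0 < M) :
    s / t * (∫ x in (0 : ℝ)..(M / (1 + M)), x ^ (-t) * (1 - x) ^ (t - s - 1))
      - t⁻¹ * M ^ (s - t) ≤ ∫ ρ in 0..M, ((1 + ρ) ^ s - 1) * ρ ^ (-1 - t) := by
  have hint : IntervalIntegrable (fun ρ : ℝ => s * (1 + ρ) ^ (s - 1) * ρ ^ (-t)) volume 0 M := by
    refine (intervalIntegral.intervalIntegrable_rpow' (r := -t) (by linarith)).continuousOn_mul ?_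
    intro ρ hρ
    rw [Set.uIcc_of_le hM.le] at hρ
    exact ContinuousAt.continuousWithinAt (ContinuousAt.const_mul
      (ContinuousAt.rpow_const (by fun_prop) (Or.inl (by linarith [hρ.1]))) _)
  have h := integral_mul_rpow_eq ht0 ht hM (f := fun ρ => (1 + ρ) ^ s - 1)
    (f' := fun ρ => s * (1 + ρ) ^ (s - 1)) (by fun_prop) (fun _ => abs_right_le hs hs1)
    (ContinuousAt.continuousWithinAt
      ((ContinuousAt.rpow_const (by fun_prop) (Or.inr hs.le)).sub continuousAt_const)) ?_ hint
  · rw [h]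
    simp_rw [mul_assoc s]
    rw [intervalIntegral.integral_const_mul, integral_one_add_rpow_mul_rpow ht hM]
    have h1 : ((1 + M) ^ s - 1) * M ^ (-t) ≤ M ^ (s - t) := by
      rw [sub_eq_add_neg s, Real.rpow_add hM]
      gcongr
      have := Real.rpow_add_le_add_rpow zero_le_one hM.le hs.le hs1
      rw [Real.one_rpow] at this
      linarith
    have h2 : t⁻¹ * (((1 + M) ^ s - 1) * M ^ (-t)) ≤ t⁻¹ * M ^ (s - t) := by gcongr
    rw [div_eq_mul_inv]
    linarith
  · intro ρ hρ
    have h1 : 0 < 1 + ρ := by linarith [hρ.1]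
    have := (((hasDerivAt_id ρ).const_add 1).rpow_const (p := s) (Or.inl h1.ne')).sub_const 1
    refine this.congr_deriv ?_
    simp

lemma integral_halfLineDiff_le {s t M : ℝ} (hs : 0 < s) (hs1 : s ≤ 1) (ht0 : 0 < t) (ht : t < 1)
    (hM : 1 ≤ M) :
    ∫ ρ in 0..M, halfLineDiff s t ρ ≤
      s / t * ((∫ x in (0 : ℝ)..1, x ^ (-t) * (1 - x) ^ (s - 1)) -
        ∫ x in (0 : ℝ)..(M / (1 + M)), x ^ (-t) * (1 - x) ^ (t - s - 1)) + t⁻¹ * M ^ (s - t) := by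
  have hM0 : 0 < M := by linarith
  simp_rw [halfLineDiff_eq]
  rw [intervalIntegral.integral_sub (intervalIntegrable_left hs hs1 ht hM0.le)
    (intervalIntegrable_right hs hs1 ht hM0.le)]
  linarith [integral_left_le hs hs1 ht0 ht hM, le_integral_right hs hs1 ht0 ht hM0]

lemma tendsto_div_one_add : Tendsto (fun M : ℝ => M / (1 + M)) atTop (𝓝[<] 1) := by
  refine tendsto_nhdsWithin_iff.2 ⟨?_, ?_⟩
  · have : Tendsto (fun M : ℝ => 1 - (1 + M)⁻¹) atTop (𝓝 (1 - 0)) :=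
      tendsto_const_nhds.sub (tendsto_inv_atTop_zero.comp (tendsto_atTop_add_const_left _ 1 tendsto_id))
    rw [sub_zero] at this
    refine this.congr' ?_
    filter_upwards [eventually_gt_atTop 0] with M hM
    field_simp
    ring
  · filter_upwards [eventually_gt_atTop 0] with M hM
    rw [Set.mem_Iio, div_lt_one (by linarith)]
    linarith

/-- The second difference of `y₊ ^ s` has a negative truncated integral for large truncations. -/
lemma exists_integral_halfLineDiff_le {s t : ℝ} (hs : 0 < s) (hst : s < t) (ht : t < 1)
    (hts : t < 2 * s) :
    ∃ c : ℝ, 0 < c ∧ ∀ᶠ M in atTop, ∫ ρ in 0..M, halfLineDiff s t ρ ≤ -c := by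
  have ht0 : 0 < t := hs.trans hst
  have hb1 := intervalIntegrable_beta (a := 1 - t) (b := s) (by linarith) hs
  have hb2 := intervalIntegrable_beta (a := 1 - t) (b := t - s) (by linarith) (by linarith)
  rw [sub_sub_cancel_left] at hb1 hb2
  -- Here `t < 2 * s` decides the sign: `t - s - 1 < s - 1`, and `1 - x` lies in `(0, 1)`, so the
  -- second integrand is pointwise larger.
  have hpos : (∫ x in (0 : ℝ)..1, x ^ (-t) * (1 - x) ^ (s - 1)) -
      ∫ x in (0 : ℝ)..1, x ^ (-t) * (1 - x) ^ (t - s - 1) < 0 := by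
    rw [← neg_pos, neg_sub, ← intervalIntegral.integral_sub hb2 hb1]
    refine intervalIntegral.intervalIntegral_pos_of_pos_on (hb2.sub hb1) (fun x hx => ?_) one_pos
    have h1 : 0 < x ^ (-t) := Real.rpow_pos_of_pos hx.1 _
    have h2 : (1 - x) ^ (s - 1) < (1 - x) ^ (t - s - 1) :=
      Real.rpow_lt_rpow_of_exponent_gt (sub_pos.2 hx.2) (by linarith [hx.1]) (by linarith)
    nlinarith
  have hlim : Tendsto (fun M : ℝ => s / t * ((∫ x in (0 : ℝ)..1, x ^ (-t) * (1 - x) ^ (s - 1)) -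
        ∫ x in (0 : ℝ)..(M / (1 + M)), x ^ (-t) * (1 - x) ^ (t - s - 1)) + t⁻¹ * M ^ (s - t)) atTop
      (𝓝 (s / t * ((∫ x in (0 : ℝ)..1, x ^ (-t) * (1 - x) ^ (s - 1)) -
        ∫ x in (0 : ℝ)..1, x ^ (-t) * (1 - x) ^ (t - s - 1)) + t⁻¹ * 0)) := by
    refine ((tendsto_const_nhds.sub ?_).const_mul _).add (Tendsto.const_mul _ ?_)
    · have hcont := intervalIntegral.continuousOn_primitive_interval' hb2 Set.left_mem_uIcc
      have hc1 := hcont 1 Set.right_mem_uIcc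
      refine Tendsto.comp (y := 𝓝[Set.uIcc 0 1] 1)
        (g := fun y : ℝ => ∫ x in (0 : ℝ)..y, x ^ (-t) * (1 - x) ^ (t - s - 1)) hc1 ?_
      rw [Set.uIcc_of_le zero_le_one]
      refine tendsto_nhdsWithin_iff.2 ⟨tendsto_div_one_add.mono_right nhdsWithin_le_nhds, ?_⟩
      filter_upwards [eventually_gt_atTop 0] with M hM
      refine ⟨by positivity, ?_⟩
      rw [div_le_one (by linarith)]
      linarith
    · rw [← neg_sub t s]
      exact tendsto_rpow_neg_atTop (sub_pos.2 hst)
  rw [mul_zero, add_zero] at hlim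
  set K := s / t * ((∫ x in (0 : ℝ)..1, x ^ (-t) * (1 - x) ^ (s - 1)) -
        ∫ x in (0 : ℝ)..1, x ^ (-t) * (1 - x) ^ (t - s - 1))
  have hK : K < 0 := mul_neg_of_pos_of_neg (by positivity) hpos
  -- Half of the negative limit is kept; the other half absorbs the error for finite `M`.
  refine ⟨-(K / 2), by linarith, ?_⟩
  filter_upwards [hlim.eventually (gt_mem_nhds (by linarith : K < K / 2)),
    eventually_ge_atTop 1] with M hM hM1
  linarith [integral_halfLineDiff_le hs (by linarith) ht0 ht hM1]

/-- In the critical case `t = s` the truncated integrals diverge to `-∞`. -/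
lemma tendsto_integral_halfLineDiff_atBot {s : ℝ} (hs : 0 < s) (hs1 : s < 1) :
    Tendsto (fun M => ∫ ρ in 0..M, halfLineDiff s s ρ) atTop atBot := by
  set B := ∫ x in (0 : ℝ)..1, x ^ (-s) * (1 - x) ^ (s - 1) with hB
  have hlog : Tendsto (fun M : ℝ => (B + s⁻¹) - Real.log (1 + M)) atTop atBot := by
    refine tendsto_atBot_add_const_left _ _ ?_
    exact tendsto_neg_atTop_atBot.comp
      (Real.tendsto_log_atTop.comp (tendsto_atTop_add_const_left _ 1 tendsto_id))
  refine tendsto_atBot_mono' _ ?_ hlog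
  filter_upwards [eventually_ge_atTop 1] with M hM
  have h := integral_halfLineDiff_le hs hs1.le hs hs1 hM
  rw [div_self hs.ne', one_mul, sub_self, Real.rpow_zero, mul_one, ← hB] at h
  have hM0 : 0 < M := by linarith
  -- At `t = s` the incomplete beta integral carries `(1 - x)⁻¹`, and `x ^ (-s) ≥ 1` on its range.
  have h2 : Real.log (1 + M) ≤
      ∫ x in (0 : ℝ)..(M / (1 + M)), x ^ (-s) * (1 - x) ^ ((0 : ℝ) - 1) := by
    have hm1 : M / (1 + M) < 1 := by rw [div_lt_one (by linarith)]; linarith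
    have hm0 : 0 < M / (1 + M) := by positivity
    have h3 : ∫ x in (0 : ℝ)..(M / (1 + M)), (1 - x)⁻¹ = Real.log (1 + M) := by
      rw [intervalIntegral.integral_comp_sub_left (fun x : ℝ => x⁻¹),
        integral_inv_of_pos (by linarith) (by norm_num)]
      congr 1
      field_simp
      ring
    rw [← h3]
    refine intervalIntegral.integral_mono_on_of_le_Ioo hm0.le ?_
      (intervalIntegrable_beta_of_lt_one hs1 hm0.le hm1) ?_
    · refine ContinuousOn.intervalIntegrable ?_
      intro x hx
      rw [Set.uIcc_of_le hm0.le] at hx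
      exact ContinuousAt.continuousWithinAt
        (ContinuousAt.inv₀ (by fun_prop) (by linarith [hx.2]))
    · intro x hx
      have h4 : 0 < 1 - x := by linarith [hx.2]
      have h5 : 1 ≤ x ^ (-s) :=
        Real.one_le_rpow_of_pos_of_le_one_of_nonpos hx.1 (by linarith [hx.2]) (by linarith)
      rw [zero_sub, Real.rpow_neg_one]
      exact le_mul_of_one_le_left (by positivity) h5
  linarith

/-- Homogeneity of the power, with `ρ = (κ / δ) r`. The value `κ = 0`, which occurs for directions
orthogonal to `x`, makes both sides vanish because `0 ^ t = 0`. -/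
lemma integral_secondDiff_eq {s t δ κ : ℝ} (ht : t ≠ 0) (hδ : 0 < δ) (hκ : 0 ≤ κ) :
    ∫ r in (0 : ℝ)..1, (2 * δ ^ s - (max (δ - κ * r) 0) ^ s - (δ + κ * r) ^ s) * r ^ (-1 - t) =
      δ ^ s * ((κ / δ) ^ t * ∫ ρ in 0..(κ / δ), halfLineDiff s t ρ) := by
  rcases hκ.eq_or_lt with rfl | hκ
  · have : ∀ r : ℝ, (2 * δ ^ s - (max (δ - 0 * r) 0) ^ s - (δ + 0 * r) ^ s) * r ^ (-1 - t) = 0 := by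
      intro r
      rw [zero_mul, sub_zero, add_zero, max_eq_left hδ.le]
      ring
    simp_rw [this]
    simp [Real.zero_rpow ht]
  have hc : 0 < κ / δ := by positivity
  have h1 : ∀ r ∈ Set.uIcc (0 : ℝ) 1,
      (2 * δ ^ s - (max (δ - κ * r) 0) ^ s - (δ + κ * r) ^ s) * r ^ (-1 - t) =
        δ ^ s * (κ / δ) ^ (1 + t) * halfLineDiff s t (κ / δ * r) := by
    intro r hr
    rw [Set.uIcc_of_le zero_le_one] at hr
    have e1 : max (δ - κ * r) 0 = δ * max (1 - κ / δ * r) 0 := by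
      rw [mul_max_of_nonneg _ _ hδ.le, mul_zero]
      congr 1
      field_simp
    have e2 : δ + κ * r = δ * (1 + κ / δ * r) := by field_simp
    have hr0 := hr.1
    have e3 : (κ / δ) ^ (1 + t) * (κ / δ) ^ (-1 - t) = 1 := by
      rw [← Real.rpow_add hc]
      norm_num
    rw [e1, e2, Real.mul_rpow hδ.le (le_max_right _ _), Real.mul_rpow hδ.le (by positivity),
      halfLineDiff, Real.mul_rpow hc.le hr0]
    linear_combination (-(δ ^ s * (2 - (max (1 - κ / δ * r) 0) ^ s - (1 + κ / δ * r) ^ s) *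
      r ^ (-1 - t))) * e3
  rw [intervalIntegral.integral_congr h1, intervalIntegral.integral_const_mul,
    intervalIntegral.integral_comp_mul_left _ hc.ne', mul_zero, mul_one, smul_eq_mul,
    Real.rpow_add hc, Real.rpow_one]
  field_simp

/-- The bound must hold for all `M ≥ 0`, because `κ / δ` is small for directions nearly orthogonal
to `x`. Below the threshold `M₀` everything is bounded and goes into `C`. -/
lemma exists_rpow_mul_integral_halfLineDiff_le {s t c : ℝ} (hs : 0 < s) (hs1 : s ≤ 1)
    (ht0 : 0 < t) (ht : t < 1)
    (hc : ∀ᶠ M in atTop, ∫ ρ in 0..M, halfLineDiff s t ρ ≤ -c) :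
    ∃ C : ℝ, ∀ M, 0 ≤ M → M ^ t * ∫ ρ in 0..M, halfLineDiff s t ρ ≤ C - c * M ^ t := by
  obtain ⟨M₀, hM₀⟩ := (hc.and (eventually_ge_atTop 0)).exists_forall_of_atTop
  have h0 : 0 ≤ M₀ := (hM₀ M₀ le_rfl).2
  have hi := intervalIntegrable_halfLineDiff (t := t) hs hs1 ht h0
  set K := ∫ ρ in 0..M₀, |halfLineDiff s t ρ| with hK
  have hK0 : 0 ≤ K := intervalIntegral.integral_nonneg h0 fun _ _ => abs_nonneg _
  refine ⟨M₀ ^ t * (K + |c|), fun M hM => ?_⟩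
  rcases le_total M M₀ with h | h
  · have h1 : ∫ ρ in 0..M, halfLineDiff s t ρ ≤ K := by
      have h2 := intervalIntegral.norm_integral_le_integral_norm (f := halfLineDiff s t)
        (μ := volume) hM
      have h3 : ∫ ρ in 0..M, ‖halfLineDiff s t ρ‖ ≤ K :=
        intervalIntegral.integral_mono_interval le_rfl hM h (.of_forall fun _ => norm_nonneg _)
          hi.norm
      exact (le_abs_self _).trans (h2.trans h3)
    have h4 : M ^ t ≤ M₀ ^ t := Real.rpow_le_rpow hM h ht0.le
    have h5 : 0 ≤ M ^ t := by positivity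
    have h6 : M ^ t * ((∫ ρ in 0..M, halfLineDiff s t ρ) + c) ≤ M₀ ^ t * (K + |c|) := by
      calc _ ≤ M ^ t * (K + |c|) := by
            gcongr
            exact le_abs_self c
        _ ≤ _ := by gcongr
    linarith
  · have h1 := (hM₀ M h).1
    have h5 : 0 ≤ M ^ t := by positivity
    have h6 : 0 ≤ M₀ ^ t * (K + |c|) := by positivity
    nlinarith

/-! ### Polar coordinates with fibrewise integrability. -/

section Polar

variable {F : Type*} [NormedAddCommGroup F] [NormedSpace ℝ F] [MeasurableSpace F] [BorelSpace F]
  [FiniteDimensional ℝ F] [Nontrivial F] (μ : Measure F) [μ.IsAddHaarMeasure]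

/-- Integration in polar coordinates, together with integrability of the radial integrals. -/
lemma integral_eq_integral_toSphere {f : F → ℝ} (hf : Integrable f μ) :
    Integrable (fun e : Metric.sphere (0 : F) 1 =>
      ∫ r in Set.Ioi (0 : ℝ), r ^ (Module.finrank ℝ F - 1) * f (r • (e : F))) μ.toSphere ∧
    ∫ x, f x ∂μ = ∫ e : Metric.sphere (0 : F) 1,
      (∫ r in Set.Ioi (0 : ℝ), r ^ (Module.finrank ℝ F - 1) * f (r • (e : F))) ∂μ.toSphere := by
  have hmp := μ.measurePreserving_homeomorphUnitSphereProd
  have hemb := (homeomorphUnitSphereProd F).measurableEmbedding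
  set g : Metric.sphere (0 : F) 1 × Set.Ioi (0 : ℝ) → ℝ := fun p => f ((p.2 : ℝ) • (p.1 : F)) with hg
  have hcomp : g ∘ homeomorphUnitSphereProd F = fun x : ({0}ᶜ : Set F) => f x := by
    ext x
    have := congrArg Subtype.val ((homeomorphUnitSphereProd F).symm_apply_apply x)
    rw [homeomorphUnitSphereProd_symm_apply_coe] at this
    simp only [hg, Function.comp_apply]
    rw [this]
  have hf' : Integrable (fun x : ({0}ᶜ : Set F) => f x) (μ.comap (↑)) := by
    have := (integrableOn_iff_comap_subtypeVal (s := ({0}ᶜ : Set F)) (f := f) (μ := μ)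
      (measurableSet_singleton _).compl).1 hf.integrableOn
    exact this
  have hgi : Integrable g (μ.toSphere.prod (.volumeIoiPow (Module.finrank ℝ F - 1))) := by
    rw [← hmp.integrable_comp_emb hemb, hcomp]
    exact hf'
  have hinner : ∀ e : Metric.sphere (0 : F) 1,
      ∫ r, g (e, r) ∂(Measure.volumeIoiPow (Module.finrank ℝ F - 1)) =
      ∫ r in Set.Ioi (0 : ℝ), r ^ (Module.finrank ℝ F - 1) * f (r • (e : F)) := by
    intro e
    simp only [Measure.volumeIoiPow, ENNReal.ofReal]
    rw [integral_withDensity_eq_integral_smul (by fun_prop), ← integral_subtype_comap measurableSet_Ioi]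
    refine integral_congr_ae (.of_forall fun r => ?_)
    simp only [hg]
    rw [NNReal.smul_def, Real.coe_toNNReal _ (pow_nonneg r.2.out.le _), smul_eq_mul]
  have h1 := hgi.integral_prod_left
  simp_rw [hinner] at h1
  refine ⟨h1, ?_⟩
  calc ∫ x, f x ∂μ = ∫ x : ({0}ᶜ : Set F), f x ∂(μ.comap (↑)) := by
        rw [integral_subtype_comap (measurableSet_singleton _).compl f, restrict_compl_singleton]
    _ = ∫ p, g p ∂(μ.toSphere.prod (.volumeIoiPow (Module.finrank ℝ F - 1))) := by
        rw [← hmp.integral_comp hemb]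
        exact integral_congr_ae (.of_forall fun x => (congrFun hcomp x).symm)
    _ = _ := by
        rw [integral_prod _ hgi]
        simp_rw [hinner]

end Polar

/-! ### Comparison with a half-space and blow-up at the sphere from inside. -/

section Ball

variable {N : ℕ}

local notation "E" => EuclideanSpace ℝ (Fin N)

/-- Comparison of `(1 - |·|²)₊ ^ s` with a half-space profile. -/
lemma le_ballPow_add {s : ℝ} (hs : 0 < s) (hs1 : s ≤ 1) (x z : E) :
    (max (1 - ‖x‖ ^ 2 - 2 * inner ℝ x z) 0) ^ s - ‖z‖ ^ (2 * s) ≤ ballPow s (x + z) := by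
  -- Expanding `‖x + z‖²`, the two profiles differ by `‖z‖²` before taking powers; subadditivity of
  -- `r ↦ r^s` turns this into `‖z‖^(2s)`.
  have h1 : max (1 - ‖x‖ ^ 2 - 2 * inner ℝ x z) 0 ≤ max (1 - ‖x + z‖ ^ 2) 0 + ‖z‖ ^ 2 := by
    rw [norm_add_sq_real]
    refine max_le ?_ (by positivity)
    linarith [le_max_left (1 - (‖x‖ ^ 2 + 2 * inner ℝ x z + ‖z‖ ^ 2)) 0]
  have h2 := (Real.rpow_le_rpow (le_max_right _ _) h1 hs.le).trans
    (Real.rpow_add_le_add_rpow (le_max_right _ _) (by positivity) hs.le hs1)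
  rw [← Real.rpow_natCast ‖z‖ 2, ← Real.rpow_mul (norm_nonneg _)] at h2
  rw [ballPow]
  push_cast at h2
  linarith

/-- The second difference of the half-space profile tangent at `x`. -/
noncomputable def tangentDiff (s t : ℝ) (x z : E) : ℝ :=
  (2 * (1 - ‖x‖ ^ 2) ^ s - (max (1 - ‖x‖ ^ 2 - 2 * |inner ℝ x z|) 0) ^ s -
    (1 - ‖x‖ ^ 2 + 2 * |inner ℝ x z|) ^ s) * ‖z‖ ^ (-((N : ℝ) + t))

lemma measurable_tangentDiff (s t : ℝ) (x : E) : Measurable (tangentDiff s t x) := by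
  unfold tangentDiff
  fun_prop

lemma integrable_indicator_tangentDiff [NeZero N] {s t : ℝ} (hs : 0 < s) (hs1 : s ≤ 1)
    (ht : t < 1) {x : E} (hx : ‖x‖ < 1) :
    Integrable ((Metric.ball (0 : E) 1).indicator (tangentDiff s t x)) := by
  have hδ : 0 < 1 - ‖x‖ ^ 2 := by nlinarith [norm_nonneg x]
  refine ((integrable_indicator_ball (N := N) (β := 1) ht).const_mul
    (4 * (1 - ‖x‖ ^ 2) ^ (s - 1))).mono'
    ((measurable_tangentDiff s t x).indicator Metric.isOpen_ball.measurableSet).aestronglyMeasurable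
    (.of_forall fun z => ?_)
  by_cases hz : z ∈ Metric.ball (0 : E) 1
  · rw [Set.indicator_of_mem hz, Set.indicator_of_mem hz]
    rcases eq_or_ne z 0 with rfl | hz0
    · have : tangentDiff s t x 0 = 0 := by
        rw [tangentDiff, inner_zero_right, abs_zero, mul_zero, sub_zero, add_zero,
          max_eq_left hδ.le]
        ring
      rw [this, norm_zero]
      positivity
    have hzp : 0 < ‖z‖ := norm_pos_iff.2 hz0
    have hin : |inner ℝ x z| ≤ ‖z‖ :=
      (abs_real_inner_le_norm x z).trans (mul_le_of_le_one_left hzp.le hx.le)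
    have hA := abs_rpow_sub_rpow_le hs hs1 le_rfl hδ
      (le_max_right (1 - ‖x‖ ^ 2 - 2 * |inner ℝ x z|) 0)
    have hB := abs_rpow_sub_rpow_le (b := 1 - ‖x‖ ^ 2 + 2 * |inner ℝ x z|) hs hs1 le_rfl hδ
      (by positivity)
    have hA' : |1 - ‖x‖ ^ 2 - max (1 - ‖x‖ ^ 2 - 2 * |inner ℝ x z|) 0| ≤ 2 * ‖z‖ := by
      have h0 := abs_nonneg (inner ℝ x z)
      rw [abs_le]
      rcases le_total (1 - ‖x‖ ^ 2 - 2 * |inner ℝ x z|) 0 with h | h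
      · rw [max_eq_right h]; constructor <;> linarith
      · rw [max_eq_left h]; constructor <;> linarith
    have hB' : |1 - ‖x‖ ^ 2 - (1 - ‖x‖ ^ 2 + 2 * |inner ℝ x z|)| ≤ 2 * ‖z‖ := by
      rw [sub_add_cancel_left, abs_neg, abs_of_nonneg (by positivity)]
      linarith
    rw [Real.rpow_one] at hA hB
    have e : ‖z‖ ^ (1 - t - N) = ‖z‖ * ‖z‖ ^ (-((N : ℝ) + t)) := by
      have := Real.rpow_add hzp 1 (-((N : ℝ) + t))
      rw [Real.rpow_one] at this
      rw [← this]
      ring_nf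
    have hp : 0 ≤ (1 - ‖x‖ ^ 2) ^ (s - 1) := by positivity
    rw [tangentDiff, norm_mul, Real.norm_of_nonneg (by positivity : 0 ≤ ‖z‖ ^ (-((N : ℝ) + t))), e,
      ← mul_assoc]
    refine mul_le_mul_of_nonneg_right ?_ (by positivity)
    have h1 := hA.trans (mul_le_mul_of_nonneg_left hA' hp)
    have h2 := hB.trans (mul_le_mul_of_nonneg_left hB' hp)
    rw [Real.norm_eq_abs]
    rw [abs_le] at h1 h2 ⊢
    constructor <;> linarith [h1.1, h1.2, h2.1, h2.2]
  · rw [Set.indicator_of_notMem hz, Set.indicator_of_notMem hz]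
    simp

/-- Adding the integrals in `z` and `-z` produces a second difference. The curvature error `2
‖z‖^(2s)` near `0` and the bound `2` on the numerator for `‖z‖ ≥ 1` are integrable against the
kernel independently of `x`, which is why `C` is uniform. -/
lemma two_mul_ballPowFrac_le [NeZero N] {s t : ℝ} (hs : 0 < s) (hs1 : s ≤ 1) (ht0 : 0 < t)
    (ht : t < 1) (hts : t < 2 * s) :
    ∃ C : ℝ, ∀ x : E, ‖x‖ < 1 → 2 * ballPowFrac s t x ≤
      (∫ z, (Metric.ball (0 : E) 1).indicator (tangentDiff s t x) z) + C := by
  have i2 := (integrable_indicator_ball (N := N) hts).const_mul 2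
  have i3 := (integrable_indicator_compl_ball (N := N) ht0).const_mul 2
  refine ⟨(∫ z : E, 2 * (Metric.ball (0 : E) 1).indicator (fun z => ‖z‖ ^ (2 * s - t - N)) z) +
    ∫ z : E, 2 * (Metric.ball (0 : E) 1)ᶜ.indicator (fun z => ‖z‖ ^ (-((N : ℝ) + t))) z, ?_⟩
  intro x hx
  have hδ : 0 < 1 - ‖x‖ ^ 2 := by nlinarith [norm_nonneg x]
  have i1 := integrable_indicator_tangentDiff (N := N) hs hs1 ht hx
  have hi := integrable_singularIntegrand (N := N) hs hs1 ht0 ht hx.ne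
  have e1 : ballPowFrac s t x = ∫ z : E, (ballPow s x - ballPow s (x + z)) / ‖z‖ ^ ((N : ℝ) + t) := by
    rw [ballPowFrac, ← integral_add_left_eq_self _ x]
    simp
  have e2 : ballPowFrac s t x = ∫ z : E, (ballPow s x - ballPow s (x - z)) / ‖z‖ ^ ((N : ℝ) + t) := by
    rw [ballPowFrac, ← integral_sub_left_eq_self _ volume x]
    simp
  have j1 : Integrable fun z : E => (ballPow s x - ballPow s (x + z)) / ‖z‖ ^ ((N : ℝ) + t) := by
    simpa using hi.comp_add_left x
  have j2 : Integrable fun z : E => (ballPow s x - ballPow s (x - z)) / ‖z‖ ^ ((N : ℝ) + t) := by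
    simpa using hi.comp_sub_left x
  have e3 : 2 * ballPowFrac s t x = ∫ z : E, ((ballPow s x - ballPow s (x + z)) / ‖z‖ ^ ((N : ℝ) + t)
      + (ballPow s x - ballPow s (x - z)) / ‖z‖ ^ ((N : ℝ) + t)) := by
    rw [integral_add j1 j2, ← e1, ← e2]
    ring
  have i12 : Integrable fun z => (Metric.ball (0 : E) 1).indicator (tangentDiff s t x) z +
      2 * (Metric.ball (0 : E) 1).indicator (fun z => ‖z‖ ^ (2 * s - t - N)) z := i1.add i2
  rw [e3, ← add_assoc, ← integral_add i1 i2, ← integral_add i12 i3]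
  refine integral_mono (j1.add j2) (i12.add i3) fun z => ?_
  simp only
  rw [div_eq_mul_inv, div_eq_mul_inv, ← add_mul, ← Real.rpow_neg (norm_nonneg _)]
  by_cases hz : z ∈ Metric.ball (0 : E) 1
  · have hz' : z ∉ (Metric.ball (0 : E) 1)ᶜ := by simpa using hz
    rw [Set.indicator_of_mem hz, Set.indicator_of_mem hz, Set.indicator_of_notMem hz', mul_zero,
      add_zero]
    rcases eq_or_ne z 0 with rfl | hz0
    · simp only [add_zero, sub_self, zero_mul, sub_zero]
      have : tangentDiff s t x 0 = 0 := by
        rw [tangentDiff, inner_zero_right, abs_zero, mul_zero, sub_zero, add_zero,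
          max_eq_left hδ.le]
        ring
      rw [this, norm_zero, zero_add]
      positivity
    have hzp : 0 < ‖z‖ := norm_pos_iff.2 hz0
    have e : ‖z‖ ^ (2 * s - t - N) = ‖z‖ ^ (2 * s) * ‖z‖ ^ (-((N : ℝ) + t)) := by
      rw [← Real.rpow_add hzp]
      ring_nf
    rw [e, tangentDiff, ← mul_assoc, ← add_mul]
    refine mul_le_mul_of_nonneg_right ?_ (by positivity)
    have hv : ballPow s x = (1 - ‖x‖ ^ 2) ^ s := by rw [ballPow, max_eq_left hδ.le]
    have h1 := le_ballPow_add hs hs1 x z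
    have h2 := le_ballPow_add hs hs1 x (-z)
    rw [inner_neg_right, norm_neg, ← sub_eq_add_neg] at h2
    -- The sign of the inner product only exchanges the two terms, and the increasing one needs no
    -- positive part.
    have h3 : (max (1 - ‖x‖ ^ 2 - 2 * |inner ℝ x z|) 0) ^ s + (1 - ‖x‖ ^ 2 + 2 * |inner ℝ x z|) ^ s =
        (max (1 - ‖x‖ ^ 2 - 2 * inner ℝ x z) 0) ^ s +
          (max (1 - ‖x‖ ^ 2 - 2 * -inner ℝ x z) 0) ^ s := by
      rcases le_total 0 (inner ℝ x z) with h | h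
      · rw [abs_of_nonneg h, max_eq_left (by linarith : 0 ≤ 1 - ‖x‖ ^ 2 - 2 * -inner ℝ x z)]
        ring_nf
      · rw [abs_of_nonpos h, max_eq_left (by linarith : 0 ≤ 1 - ‖x‖ ^ 2 - 2 * inner ℝ x z)]
        ring_nf
    linarith
  · have hz' : z ∈ (Metric.ball (0 : E) 1)ᶜ := hz
    rw [Set.indicator_of_notMem hz, Set.indicator_of_notMem hz, Set.indicator_of_mem hz', mul_zero,
      zero_add, zero_add]
    refine mul_le_mul_of_nonneg_right ?_ (by positivity)
    linarith [ballPow_le_one hs.le x, ballPow_nonneg s (x + z), ballPow_nonneg s (x - z)]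

/-- The Jacobian `r^(N-1)` turns the kernel into `r^(-1-t)`, so the dimension disappears from each
radial integral. -/
lemma radialIntegral_tangentDiff [NeZero N] {s t : ℝ} (ht0 : 0 < t) {x : E} (hx : ‖x‖ < 1)
    (e : Metric.sphere (0 : E) 1) :
    ∫ r in Set.Ioi (0 : ℝ), r ^ (Module.finrank ℝ E - 1) *
      (Metric.ball (0 : E) 1).indicator (tangentDiff s t x) (r • (e : E)) =
    (1 - ‖x‖ ^ 2) ^ s * ((2 * |inner ℝ x (e : E)| / (1 - ‖x‖ ^ 2)) ^ t *
      ∫ ρ in 0..(2 * |inner ℝ x (e : E)| / (1 - ‖x‖ ^ 2)), halfLineDiff s t ρ) := by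
  have hδ : 0 < 1 - ‖x‖ ^ 2 := by nlinarith [norm_nonneg x]
  have he : ‖(e : E)‖ = 1 := by simp
  rw [← integral_secondDiff_eq ht0.ne' hδ (by positivity), intervalIntegral.integral_of_le zero_le_one,
    integral_Ioc_eq_integral_Ioo, ← integral_indicator measurableSet_Ioi,
    ← integral_indicator measurableSet_Ioo]
  congr 1
  ext r
  by_cases hr : r ∈ Set.Ioo (0 : ℝ) 1
  · have hr0 : 0 < r := hr.1
    have hn : ‖r • (e : E)‖ = r := by rw [norm_smul, he, Real.norm_of_nonneg hr0.le, mul_one]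
    rw [Set.indicator_of_mem hr, Set.indicator_of_mem (Set.mem_Ioi.2 hr0),
      Set.indicator_of_mem (by rw [mem_ball_zero_iff, hn]; exact hr.2), tangentDiff, hn,
      real_inner_smul_right, abs_mul, abs_of_pos hr0, finrank_euclideanSpace, Fintype.card_fin]
    have e1 : r ^ (N - 1) * r ^ (-((N : ℝ) + t)) = r ^ (-1 - t) := by
      rw [← Real.rpow_natCast, ← Real.rpow_add hr0, Nat.cast_sub NeZero.one_le]
      congr 1
      push_cast; ring
    rw [← e1]
    ring_nf
  · rw [Set.indicator_of_notMem hr]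
    by_cases hr0 : r ∈ Set.Ioi (0 : ℝ)
    · rw [Set.indicator_of_mem hr0, Set.indicator_of_notMem, mul_zero]
      have : 0 < r := hr0
      rw [mem_ball_zero_iff, norm_smul, he, Real.norm_of_nonneg this.le, mul_one]
      exact fun h => hr ⟨this, h⟩
    · rw [Set.indicator_of_notMem hr0]

/-- The spherical averages of `|x · e| ^ t` are bounded below for `|x| ≥ 1 / 2`. -/
lemma exists_le_integral_abs_inner_rpow [NeZero N] {t : ℝ} (ht0 : 0 < t) :
    ∃ m : ℝ, 0 < m ∧ ∀ x : E, 1 / 2 ≤ ‖x‖ → m ≤ ∫ e : Metric.sphere (0 : E) 1,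
      (2 * |inner ℝ x (e : E)|) ^ t ∂(volume : Measure E).toSphere := by
  -- `B` bounds from below the surface measure of every cap of radius `1`, uniformly in its centre;
  -- the cap used is centred at `x / ‖x‖`.
  set B := Measure.toSphereBallBound (Module.finrank ℝ E) 1 * (volume : Measure E).real
    (Metric.ball 0 1) with hB
  have hBpos : 0 < B := mul_pos (by exact_mod_cast Measure.toSphereBallBound_pos _ _)
    (ENNReal.toReal_pos
    (Metric.measure_ball_pos _ _ one_pos).ne' measure_ball_lt_top.ne)
  refine ⟨B * (1 / 2) ^ t, by positivity, fun x hx => ?_⟩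
  have hx0 : 0 < ‖x‖ := by linarith
  let ω : Metric.sphere (0 : E) 1 := ⟨‖x‖⁻¹ • x, by
    rw [mem_sphere_zero_iff_norm, norm_smul, norm_inv, norm_norm, inv_mul_cancel₀ hx0.ne']⟩
  have hball := Measure.toSphereBallBound_mul_measureReal_unitBall_le_toSphere_ball
    (volume : Measure E) one_pos ω
  have hcont : Continuous fun e : Metric.sphere (0 : E) 1 => (2 * |inner ℝ x (e : E)|) ^ t :=
    Continuous.rpow_const (by fun_prop) fun _ => Or.inr ht0.le
  have hint : Integrable (fun e : Metric.sphere (0 : E) 1 => (2 * |inner ℝ x (e : E)|) ^ t)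
      (volume : Measure E).toSphere := hcont.integrable_of_hasCompactSupport
        (HasCompactSupport.of_compactSpace _)
  calc B * (1 / 2) ^ t ≤ ∫ _ in Metric.ball ω 1, ((1 : ℝ) / 2) ^ t ∂(volume : Measure E).toSphere := by
        rw [setIntegral_const, smul_eq_mul]
        gcongr
    _ ≤ ∫ e in Metric.ball ω 1, (2 * |inner ℝ x (e : E)|) ^ t ∂(volume : Measure E).toSphere := by
        refine setIntegral_mono_on (integrableOn_const (measure_ne_top _ _)) hint.integrableOn
          Metric.isOpen_ball.measurableSet fun e he => ?_
        refine Real.rpow_le_rpow (by positivity) ?_ ht0.le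
        have he1 : ‖(e : E)‖ = 1 := by simp
        have hd : ‖(e : E) - ‖x‖⁻¹ • x‖ < 1 := by
          rw [← dist_eq_norm]
          exact he
        have h1 : ‖(e : E) - ‖x‖⁻¹ • x‖ ^ 2 = 2 - 2 * (‖x‖⁻¹ * inner ℝ x (e : E)) := by
          rw [norm_sub_sq_real, real_inner_smul_right, real_inner_comm, he1, norm_smul, norm_inv,
            norm_norm, inv_mul_cancel₀ hx0.ne']
          ring
        have h2 : ‖(e : E) - ‖x‖⁻¹ • x‖ ^ 2 < 1 := by
          nlinarith [norm_nonneg ((e : E) - ‖x‖⁻¹ • x)]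
        -- On the cap `2 |x·e| > ‖x‖ ≥ 1/2`, whence the factor `(1 / 2) ^ t`.
        have h3 : 1 / 2 < ‖x‖⁻¹ * inner ℝ x (e : E) := by linarith
        rw [inv_mul_eq_div, lt_div_iff₀ hx0] at h3
        have := le_abs_self (inner ℝ x (e : E))
        linarith
    _ ≤ _ := setIntegral_le_integral hint (.of_forall fun e => by positivity)

/-- Upper bound near the sphere, from inside the ball, in terms of the truncated half-line
integrals. -/
lemma exists_ballPowFrac_le [NeZero N] {s t : ℝ} (hs : 0 < s) (hs1 : s ≤ 1) (ht0 : 0 < t)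
    (ht : t < 1) (hts : t < 2 * s) :
    ∃ m C₁ : ℝ, 0 < m ∧ ∀ c : ℝ, 0 < c →
      (∀ᶠ M in atTop, ∫ ρ in 0..M, halfLineDiff s t ρ ≤ -c) →
      ∃ C₂ : ℝ, 0 ≤ C₂ ∧ ∀ x : E, 1 / 2 ≤ ‖x‖ → ‖x‖ < 1 →
        ballPowFrac s t x ≤ C₁ + C₂ * (1 - ‖x‖ ^ 2) ^ s - c * m * (1 - ‖x‖ ^ 2) ^ (s - t) := by
  obtain ⟨m, hm, hmx⟩ := exists_le_integral_abs_inner_rpow (N := N) ht0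
  obtain ⟨C₁, hC₁⟩ := two_mul_ballPowFrac_le (N := N) hs hs1 ht0 ht hts
  -- These two constants are fixed before `c`, so that the critical case may choose `c` in terms of
  -- them. The halves undo the symmetrization.
  refine ⟨m / 2, C₁ / 2, by positivity, fun c hc hcM => ?_⟩
  obtain ⟨C₂, hC₂⟩ := exists_rpow_mul_integral_halfLineDiff_le hs hs1 ht0 ht hcM
  set σ := (volume : Measure E).toSphere with hσ
  refine ⟨|C₂| * σ.real Set.univ / 2, by positivity, fun x hx hx1 => ?_⟩
  have hδ : 0 < 1 - ‖x‖ ^ 2 := by nlinarith [norm_nonneg x]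
  obtain ⟨hi, hpolar⟩ := integral_eq_integral_toSphere (volume : Measure E)
    (integrable_indicator_tangentDiff (N := N) hs hs1 ht hx1)
  simp_rw [radialIntegral_tangentDiff (s := s) ht0 hx1] at hi hpolar
  have hcont : Continuous fun e : Metric.sphere (0 : E) 1 => (2 * |inner ℝ x (e : E)|) ^ t :=
    Continuous.rpow_const (by fun_prop) fun _ => Or.inr ht0.le
  have hint : Integrable (fun e : Metric.sphere (0 : E) 1 => (2 * |inner ℝ x (e : E)|) ^ t) σ :=
    hcont.integrable_of_hasCompactSupport (HasCompactSupport.of_compactSpace _)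
  have hle : ∫ z, (Metric.ball (0 : E) 1).indicator (tangentDiff s t x) z ≤
      |C₂| * (1 - ‖x‖ ^ 2) ^ s * σ.real Set.univ - c * (1 - ‖x‖ ^ 2) ^ (s - t) *
        ∫ e : Metric.sphere (0 : E) 1, (2 * |inner ℝ x (e : E)|) ^ t ∂σ := by
    have e1 : |C₂| * (1 - ‖x‖ ^ 2) ^ s * σ.real Set.univ - c * (1 - ‖x‖ ^ 2) ^ (s - t) *
        ∫ e : Metric.sphere (0 : E) 1, (2 * |inner ℝ x (e : E)|) ^ t ∂σ =
        ∫ e : Metric.sphere (0 : E) 1, (|C₂| * (1 - ‖x‖ ^ 2) ^ s - c * (1 - ‖x‖ ^ 2) ^ (s - t) *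
          (2 * |inner ℝ x (e : E)|) ^ t) ∂σ := by
      rw [integral_sub (integrable_const _) (hint.const_mul _), integral_const, integral_const_mul,
        smul_eq_mul, mul_comm (|C₂| * (1 - ‖x‖ ^ 2) ^ s)]
    rw [hpolar, e1]
    refine integral_mono hi ((integrable_const _).sub (hint.const_mul _)) fun e => ?_
    have h1 := hC₂ (2 * |inner ℝ x (e : E)| / (1 - ‖x‖ ^ 2)) (by positivity)
    have h2 := mul_le_mul_of_nonneg_left h1 (Real.rpow_nonneg hδ.le s)
    refine h2.trans ?_
    rw [Real.div_rpow (by positivity) hδ.le, Real.rpow_sub hδ, mul_sub]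
    have h3 : (1 - ‖x‖ ^ 2) ^ s * C₂ ≤ |C₂| * (1 - ‖x‖ ^ 2) ^ s := by
      rw [mul_comm]
      gcongr
      exact le_abs_self _
    refine (sub_le_sub_right h3 _).trans (le_of_eq ?_)
    ring
  have h4 : c * (1 - ‖x‖ ^ 2) ^ (s - t) * m ≤ c * (1 - ‖x‖ ^ 2) ^ (s - t) *
      ∫ e : Metric.sphere (0 : E) 1, (2 * |inner ℝ x (e : E)|) ^ t ∂σ := by
    gcongr
    exact hmx x hx
  linarith [hC₁ x hx1]

/-! ### Integrability thresholds. -/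

/-- The condition on `p` says exactly that `t < s + 1/p`, which leaves room for an exponent `β > t`
with `(β - s) p < 1`. -/
lemma memLp_fracLaplacian_torsionFunction_of_le [NeZero N] {s t : ℝ} (hs : 0 < s) (hst : s ≤ t)
    (ht1 : t < 1) {p : ℝ≥0∞} (hp : 1 ≤ p) (hp' : p ≠ ∞) (h : (t - s) * p.toReal < 1) :
    MemLp (fracLaplacian (t / 2) (torsionFunction N s)) p volume := by
  have hp1 : 1 ≤ p.toReal := by simpa using ENNReal.toReal_mono hp' hp
  have hp0 : 0 < p.toReal := by linarith
  have h1 : t < min 1 (s + 1 / p.toReal) := by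
    refine lt_min ht1 ?_
    have := (lt_div_iff₀ hp0).2 h
    linarith
  obtain ⟨β, hβ1, hβ2⟩ := exists_between h1
  rw [lt_min_iff] at hβ2
  refine memLp_fracLaplacian_torsionFunction hs (hst.trans hβ1.le) hβ2.1.le (by linarith) ht1 hβ1 hp
    (Or.inr ⟨hp', (lt_div_iff₀ hp0).1 ?_⟩)
  linarith [hβ2.2]

/-- Cutting off at radius `1/2` keeps the weight `r^(N-1)` bounded below, and `1 - r² ≤ 2 (1 - r)`
reduces the claim to the divergence of `∫ dr / (1 - r)` at `1`. -/
lemma not_integrableOn_inv_one_sub_norm_sq [NeZero N] :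
    ¬ IntegrableOn (fun x : E => if 1 / 2 ≤ ‖x‖ then (1 - ‖x‖ ^ 2)⁻¹ else 0)
      (Metric.ball 0 1) := by
  intro h
  rw [integrableOn_fun_norm_addHaar volume
    (f := fun y => if 1 / 2 ≤ y then (1 - y ^ 2)⁻¹ else 0)] at h
  have h1 := (h.mono_set (Set.Ioo_subset_Ioo_left (by norm_num : (0 : ℝ) ≤ 1 / 2))).const_mul
    (2 * 2 ^ (N - 1))
  have h2 : IntegrableOn (fun y : ℝ => (y - 1)⁻¹) (Set.Ioo (1 / 2) 1) := by
    refine Integrable.mono' h1 (Measurable.aestronglyMeasurable (by fun_prop)) ?_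
    filter_upwards [ae_restrict_mem measurableSet_Ioo] with y hy
    have hy1 : 0 < 1 - y := sub_pos.2 hy.2
    have hy0 : 1 / 2 < y := hy.1
    rw [if_pos hy.1.le, finrank_euclideanSpace, Fintype.card_fin, smul_eq_mul, norm_inv,
      Real.norm_eq_abs, abs_sub_comm, abs_of_pos hy1]
    have e1 : (1 : ℝ) ≤ 2 ^ (N - 1) * y ^ (N - 1) := by
      rw [← mul_pow]
      exact one_le_pow₀ (by linarith)
    have e2 : (1 - y)⁻¹ ≤ 2 * (1 - y ^ 2)⁻¹ := by
      have : 0 < 1 - y ^ 2 := by nlinarith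
      rw [inv_eq_one_div, ← div_eq_mul_inv, div_le_div_iff₀ hy1 this]
      nlinarith
    calc (1 - y)⁻¹ ≤ 2 * (1 - y ^ 2)⁻¹ := e2
      _ ≤ (2 * (1 - y ^ 2)⁻¹) * (2 ^ (N - 1) * y ^ (N - 1)) :=
        le_mul_of_one_le_right ((inv_nonneg.2 hy1.le).trans e2) e1
      _ = _ := by ring
  rw [← intervalIntegrable_iff_integrableOn_Ioo_of_le (by norm_num),
    intervalIntegrable_sub_inv_iff] at h2
  rcases h2 with h2 | h2
  · norm_num at h2
  · exact h2 Set.right_mem_uIcc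

/-- The ball has finite measure, so it is enough to exclude `q = 1/(t - s)`. There the blow-up bound
would put `δ^(s-t)` in `L^q`, although its `q`-th power is `1/δ`. -/
lemma not_memLp_fracLaplacian_torsionFunction [NeZero N] {s t : ℝ} (hs : 0 < s) (hst : s < t)
    (ht1 : t < 1) (hts : t < 2 * s) {p : ℝ≥0∞} (hp : ENNReal.ofReal (1 / (t - s)) ≤ p) :
    ¬ MemLp (fracLaplacian (t / 2) (torsionFunction N s)) p
      (volume.restrict (Metric.ball (0 : E) 1)) := by
  intro h
  have ht0 : 0 < t := hs.trans hst
  have hs1 : s ≤ 1 := by linarith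
  have : IsFiniteMeasure (volume.restrict (Metric.ball (0 : E) 1)) :=
    ⟨by rw [Measure.restrict_apply_univ]; exact measure_ball_lt_top⟩
  have h := h.mono_exponent hp
  obtain ⟨c, hc, hcM⟩ := exists_integral_halfLineDiff_le hs hst ht1 hts
  obtain ⟨m, C₁, hm, hmC⟩ := exists_ballPowFrac_le (N := N) hs hs1 ht0 ht1 hts
  obtain ⟨C₂, hC₂, hC⟩ := hmC c hc hcM
  have hA := torsionFracConst_pos (N := N) hs ht0 ht1
  set A := torsionFracConst N s t
  set q := 1 / (t - s) with hq
  have hq0 : 0 < q := one_div_pos.2 (sub_pos.2 hst)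
  have hmeas : Measurable fun x : E => if 1 / 2 ≤ ‖x‖ then (1 - ‖x‖ ^ 2) ^ (s - t) else 0 :=
    Measurable.ite (measurableSet_le measurable_const measurable_norm) (by fun_prop)
      measurable_const
  have hmem : MemLp (fun x : E => if 1 / 2 ≤ ‖x‖ then (1 - ‖x‖ ^ 2) ^ (s - t) else 0)
      (ENNReal.ofReal q) (volume.restrict (Metric.ball (0 : E) 1)) := by
    have hg := (((memLp_const (|C₁| + C₂)).add (h.norm.const_mul A⁻¹)).const_mul (c * m)⁻¹)
    refine hg.mono' hmeas.aestronglyMeasurable ?_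
    filter_upwards [ae_restrict_mem Metric.isOpen_ball.measurableSet] with x hx
    have hx1 : ‖x‖ < 1 := by simpa using hx
    have hδ : 0 < 1 - ‖x‖ ^ 2 := by nlinarith [norm_nonneg x]
    simp only [Pi.add_apply]
    split_ifs with hx2
    · rw [Real.norm_of_nonneg (by positivity), inv_mul_eq_div, le_div_iff₀ (by positivity),
        fracLaplacian_torsionFunction hs hs1 ht0 ht1 hx1.ne, norm_mul, Real.norm_of_nonneg hA.le,
        inv_mul_cancel_left₀ hA.ne', Real.norm_eq_abs]
      have h1 := hC x hx2 hx1
      have h2 : C₂ * (1 - ‖x‖ ^ 2) ^ s ≤ C₂ := mul_le_of_le_one_right hC₂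
        (Real.rpow_le_one hδ.le (by nlinarith [norm_nonneg x]) hs.le)
      linarith [le_abs_self C₁, neg_abs_le (ballPowFrac s t x)]
    · rw [norm_zero]
      positivity
  have hint := hmem.integrable_norm_rpow (by simpa using hq0) ENNReal.ofReal_ne_top
  refine not_integrableOn_inv_one_sub_norm_sq (N := N) (hint.congr ?_)
  filter_upwards [ae_restrict_mem Metric.isOpen_ball.measurableSet] with x hx
  have hx1 : ‖x‖ < 1 := by simpa using hx
  have hδ : 0 < 1 - ‖x‖ ^ 2 := by nlinarith [norm_nonneg x]
  rw [ENNReal.toReal_ofReal hq0.le]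
  split_ifs with hx2
  · rw [Real.norm_of_nonneg (by positivity), ← Real.rpow_mul hδ.le, ← Real.rpow_neg_one]
    congr 1
    have : t - s ≠ 0 := (sub_pos.2 hst).ne'
    rw [hq]
    field_simp
    ring
  · rw [norm_zero, Real.zero_rpow hq0.ne']

lemma not_memLp_top_fracLaplacian_torsionFunction [NeZero N] {s : ℝ} (hs : 0 < s) (hs1 : s < 1) :
    ¬ MemLp (fracLaplacian (s / 2) (torsionFunction N s)) ∞
      (volume.restrict (Metric.ball (0 : E) 1)) := by
  intro h
  obtain ⟨L, hL⟩ : ∃ L : ℝ, ∀ᵐ x ∂(volume.restrict (Metric.ball (0 : E) 1)),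
      ‖fracLaplacian (s / 2) (torsionFunction N s) x‖ ≤ L := by
    have h1 := h.2
    rw [eLpNorm_exponent_top] at h1
    refine ⟨(eLpNormEssSup (fracLaplacian (s / 2) (torsionFunction N s))
      (volume.restrict (Metric.ball (0 : E) 1))).toReal, (ae_le_eLpNormEssSup (f := fracLaplacian (s / 2) (torsionFunction N s))
      (μ := volume.restrict (Metric.ball (0 : E) 1))).mono fun x hx => ?_⟩
    have := ENNReal.toReal_mono h1.ne hx
    simpa using this
  have hA := torsionFracConst_pos (N := N) hs hs hs1
  obtain ⟨m, C₁, hm, hmC⟩ := exists_ballPowFrac_le (N := N) hs hs1.le hs hs1 (by linarith)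
  set A := torsionFracConst N s s
  -- In `c * m` the summand `|C₁|` absorbs `C₁`, the `1` absorbs `C₂ δ^s`, and the rest forces the
  -- fractional Laplacian beyond `L`. As `C₂` depends on `c`, the region where `C₂ δ^s < 1` is
  -- chosen only afterwards; it is open and nonempty, hence not null.
  set c := (|C₁| + 1 + (|L| + 1) / A) / m with hc
  have hc0 : 0 < c := by positivity
  obtain ⟨C₂, hC₂, hC⟩ := hmC c hc0
    ((tendsto_integral_halfLineDiff_atBot hs hs1).eventually (eventually_le_atBot (-c)))
  simp_rw [sub_self, Real.rpow_zero, mul_one] at hC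
  have hU : IsOpen {x : E | 1 / 2 < ‖x‖ ∧ ‖x‖ < 1 ∧ C₂ * (max (1 - ‖x‖ ^ 2) 0) ^ s < 1} := by
    have hcont : Continuous fun x : E => C₂ * (max (1 - ‖x‖ ^ 2) 0) ^ s :=
      continuous_const.mul (Continuous.rpow_const (by fun_prop) fun _ => Or.inr hs.le)
    exact (isOpen_lt continuous_const continuous_norm).inter
      ((isOpen_lt continuous_norm continuous_const).inter (isOpen_lt hcont continuous_const))
  have hne : {x : E | 1 / 2 < ‖x‖ ∧ ‖x‖ < 1 ∧ C₂ * (max (1 - ‖x‖ ^ 2) 0) ^ s < 1}.Nonempty := by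
    have hcont : Continuous fun r : ℝ => C₂ * (max (1 - r ^ 2) 0) ^ s :=
      continuous_const.mul (Continuous.rpow_const (by fun_prop) fun _ => Or.inr hs.le)
    have h1 : ∀ᶠ r in 𝓝[<] (1 : ℝ), C₂ * (max (1 - r ^ 2) 0) ^ s < 1 := by
      refine (hcont.tendsto 1).mono_left nhdsWithin_le_nhds |>.eventually (gt_mem_nhds ?_)
      simp [Real.zero_rpow hs.ne']
    obtain ⟨r, hr1, hr2, hr3⟩ := (h1.and (Ioo_mem_nhdsLT (by norm_num : (1 / 2 : ℝ) < 1))).exists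
    obtain ⟨e, he⟩ := exists_norm_eq E (by linarith : 0 ≤ r)
    exact ⟨e, by rw [he]; exact hr2, by rw [he]; exact hr3, by rw [he]; exact hr1⟩
  refine (hU.measure_pos volume hne).ne' ?_
  rw [ae_restrict_iff' Metric.isOpen_ball.measurableSet, ae_iff] at hL
  refine measure_mono_null (fun x hx => ?_) hL
  obtain ⟨hx1, hx2, hx3⟩ := hx
  have hδ : 0 < 1 - ‖x‖ ^ 2 := by nlinarith [norm_nonneg x]
  rw [max_eq_left hδ.le] at hx3
  have h1 := hC x hx1.le hx2
  have h2 : c * m = |C₁| + 1 + (|L| + 1) / A := by rw [hc, div_mul_cancel₀ _ hm.ne']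
  have h3 : (|L| + 1) / A ≤ |ballPowFrac s s x| := by
    linarith [neg_abs_le (ballPowFrac s s x), le_abs_self C₁]
  rw [div_le_iff₀ hA] at h3
  simp only [Set.mem_ofPred_eq, Classical.not_imp, not_le, mem_ball_zero_iff]
  refine ⟨hx2, ?_⟩
  rw [fracLaplacian_torsionFunction hs hs1.le hs hs1 hx2.ne, norm_mul, Real.norm_of_nonneg hA.le,
    Real.norm_eq_abs]
  linarith [le_abs_self L]

end Ball

theorem mainTheorem9 (N : ℕ) (hN : 2 ≤ N) (s : ℝ) (hs0 : 0 < s) (hs1 : s < 1) :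
    -- the pointwise principal value exists off the unit sphere (a null set)
    (∀ t : ℝ, 0 < t → t < min 1 (2 * s) →
      ∀ x : EuclideanSpace ℝ (Fin N), ‖x‖ ≠ 1 →
        HasFracLaplacianAt (t / 2) (torsionFunction N s) x
          (fracLaplacian (t / 2) (torsionFunction N s) x)) ∧
    -- (i)
    (∀ t : ℝ, 0 < t → t < s → ∀ p : ℝ≥0∞, 1 ≤ p →
      MemLp (fracLaplacian (t / 2) (torsionFunction N s)) p volume) ∧
    -- (ii)
    ((∀ p : ℝ≥0∞, 1 ≤ p → p < ∞ →
        MemLp (fracLaplacian (s / 2) (torsionFunction N s)) p volume) ∧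
      ¬ MemLp (fracLaplacian (s / 2) (torsionFunction N s)) ∞
        (volume.restrict (Metric.ball (0 : EuclideanSpace ℝ (Fin N)) 1))) ∧
    -- (iii)
    (∀ t : ℝ, s < t → t < min 1 (2 * s) →
      (∀ p : ℝ≥0∞, 1 ≤ p → p < ENNReal.ofReal (1 / (t - s)) →
        MemLp (fracLaplacian (t / 2) (torsionFunction N s)) p volume) ∧
      (∀ p : ℝ≥0∞, ENNReal.ofReal (1 / (t - s)) ≤ p →
        ¬ MemLp (fracLaplacian (t / 2) (torsionFunction N s)) p
          (volume.restrict (Metric.ball (0 : EuclideanSpace ℝ (Fin N)) 1)))) := by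
  have : NeZero N := ⟨by omega⟩
  refine ⟨fun t ht0 ht x hx => ?_, fun t ht0 ht p hp => ?_, ⟨fun p hp hp' => ?_, ?_⟩,
    fun t hst ht => ⟨fun p hp hp' => ?_, fun p hp => ?_⟩⟩
  · have ht1 := (lt_min_iff.1 ht).1
    rw [fracLaplacian_torsionFunction hs0 hs1.le ht0 ht1 hx]
    exact hasFracLaplacianAt_torsionFunction hs0 hs1.le ht0 ht1 hx
  · exact memLp_fracLaplacian_torsionFunction hs0 le_rfl hs1.le ht0 (ht.trans hs1) ht hp
      (Or.inl rfl)
  · exact memLp_fracLaplacian_torsionFunction_of_le hs0 le_rfl hs1 hp hp'.ne (by simp)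
  · exact not_memLp_top_fracLaplacian_torsionFunction hs0 hs1
  · have hst' : 0 < t - s := sub_pos.2 hst
    refine memLp_fracLaplacian_torsionFunction_of_le hs0 hst.le (lt_min_iff.1 ht).1 hp
      (hp'.trans_le le_top).ne ?_
    have h1 := (ENNReal.lt_ofReal_iff_toReal_lt (hp'.trans_le le_top).ne).1 hp'
    rw [lt_div_iff₀ hst'] at h1
    linarith
  · exact not_memLp_fracLaplacian_torsionFunction hs0 hst (lt_min_iff.1 ht).1 (lt_min_iff.1 ht).2 hp
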